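/- For points $x,y\in\{0,1\}^d$ let $\mathrm{ham}(x,y)$ be their Hamming distance. Given a set $P=\{p_1,\dots,p_n\}$ of $n$ distinct points of $\{0,1\}^d$, the $\ell$-center problem asks for a set $T$ of $\ell$ points of $\{0,1\}^d$ that minimizes $\max_{v\in P}\min_{u\in T}\mathrm{ham}(v,u)$, and the minimum-diameter $\ell$-clustering problem asks for a partition of $P$ into $\ell$ clusters $P_1,\dots,P_\ell$ that minimizes $\max_i\max_{u,v\in P_i}\mathrm{ham}(u,v)$. The randomized procedure $CENTER(\ell,P,\delta)$, with a constant $K\in\mathbb{N}$, works as follows. Put $k=\lceil K\log n/\delta^2\rceil$. For each threshold $t=1,(1+\delta),\dots,(1+\delta)^{\lceil\log_{1+\delta}d\rceil}$ generate a random $k\times d$ $0$-$1$ matrix $F_t$ whose entries are independent and equal to $1$ with probability $\frac1{4t}$ (the matrices being independent as well), and compute $f_t(p_i)=F_tp_i^{\top}\bmod 2$ for all $i$. The approximate distance $W_{ij}$ is the smallest threshold $t$ with $\mathrm{ham}(f_t(p_i),f_t(p_j))\le (C_1(t)+\frac{\delta}{30})k$, where $C_1(t)=\frac12\bigl(1-(1-\frac1{2t})^t\bigr)$;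 it is searched for by binary search. Starting from $T=\{p_1\}$, the procedure $\ell-1$ times adds to $T$ a point $p_m\in P\setminus T$ that maximizes $\min_{p_q\in T}W_{qm}$, and it keeps for every point outside $T$ the smallest distance $W$ to $T$ and a center attaining it. It returns $T$ and the induced clustering, in which each center belongs to its own cluster and each other point belongs to the cluster of the center recorded for it. Time is the number of elementary steps on a unit-cost random access machine, where an arithmetic operation or a comparison on integers or reals (including $\log$, power and rounding), a Boolean operation, a random draw, and reading or writing an array cell cost one step each. **Theorem.** For all constants $\alpha\ge1$ and $\beta\in\mathbb{N}$ there is a constant $K_0$ such that for every $K\ge K_0$ there is a constant $C$ for which the following holds. Let $P$ be a set of $n$ distinct points $p_1,\dots,p_n\in\{0,1\}^d$, let $\ell$ be an integer with $1\le\ell<n$, and let $\epsilon\in(0,1/2)$. 1. If $d\ge2$, then for every outcome of the random draws $CENTER(\ell,P,\epsilon/5)$ (including the computation of the induced clustering) takes at most $$C\cdot\frac{n\log n\,\bigl(d\log_{1+\epsilon/5}d+\ell\log\log_{1+\epsilon/5}d\bigr)}{\epsilon^2}$$ steps. 2. If $d\le 2^{n^\beta}$, then with probability at least $1-n^{-\alpha}$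 the following two statements both hold: the returned set $T$ consists of $\ell$ points of $P$ and satisfies $\max_{v\in P}\min_{u\in T}\mathrm{ham}(v,u)\le(2+\epsilon)\max_{v\in P}\min_{u\in T'}\mathrm{ham}(v,u)$ for every set $T'$ of $\ell$ points of $\{0,1\}^d$; and the induced clustering is a partition of $P$ into $\ell$ non-empty clusters whose maximum diameter is at most $2+\epsilon$ times the maximum cluster diameter of any partition of $P$ into $\ell$ clusters. -/

import Mathlib

open MeasureTheory

noncomputable section

namespace HammingCluster

/-! ### The two clustering problems in the Hamming space -/

/-- The Hamming cube `{0,1}^d`; its distance is Mathlib's `hammingDist`. -/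
abbrev Cube (d : ℕ) : Type := Fin d → Bool

/-- `max_{v ∈ P} min_{u ∈ T} ham(v,u)` for the points `p i` and a non-empty set `T` of centers. -/
def radius {n d : ℕ} (p : Fin n → Cube d) (T : Finset (Cube d)) : ℕ :=
  Finset.univ.sup fun i => sInf ((fun u => hammingDist (p i) u) '' (T : Set (Cube d)))

/-- `T` consists of `ℓ` points of the cube, and its radius is at most `ρ` times the radius of
any set of `ℓ` points of the cube. -/
def IsCenterApprox {n d : ℕ} (p : Fin n → Cube d) (ℓ : ℕ) (ρ : ℝ) (T : Finset (Cube d)) : Prop :=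
  T.card = ℓ ∧ ∀ T' : Finset (Cube d), T'.card = ℓ → (radius p T : ℝ) ≤ ρ * (radius p T' : ℝ)

/-- The largest diameter of a cluster `{p i | g i = c}`, for a partition of the points into `ℓ`
clusters that is given by the labelling `g`. -/
def maxDiam {n d ℓ : ℕ} (p : Fin n → Cube d) (g : Fin n → Fin ℓ) : ℕ :=
  (Finset.univ.filter fun q : Fin n × Fin n => g q.1 = g q.2).sup
    fun q => hammingDist (p q.1) (p q.2)

/-- The labelling `g` partitions the points into `ℓ` non-empty clusters, and its largest cluster
diameter is at most `ρ` times that of any partition into `ℓ` clusters (empty ones allowed). -/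
def IsDiamApprox {n d ℓ : ℕ} (p : Fin n → Cube d) (ρ : ℝ) (g : Fin n → Fin ℓ) : Prop :=
  Function.Surjective g ∧ ∀ g' : Fin n → Fin ℓ, (maxDiam p g : ℝ) ≤ ρ * (maxDiam p g' : ℝ)

/-! ### The machine model: a unit-cost random access machine with a step counter

A computation returns a value together with the number of elementary steps that were executed.
Elementary steps (one `step` each) are: an arithmetic operation or a comparison on integers or
reals (including `log`, power and rounding up), a Boolean operation, a draw of a random number,
reading a cell of an array and writing a cell of an array. Every pass through a loop costs one
further step. Arrays are functions on indices, and they are used linearly, so that a write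
is done in place; a fresh array costs nothing before its cells are written. -/

/-- A value together with the number of steps spent on computing it. -/
structure Timed (α : Type) where
  val : α
  cost : ℕ

instance : Monad Timed where
  pure a := ⟨a, 0⟩
  bind x f := ⟨(f x.val).val, x.cost + (f x.val).cost⟩

/-- One elementary step, with result `a`. -/
def step {α : Type} (a : α) : Timed α := ⟨a, 1⟩

/-- The loop `for i = 0, …, m - 1 do s := body i s`. -/
def loop {σ : Type} (m : ℕ) (s : σ) (body : ℕ → σ → Timed σ) : Timed σ :=
  match m with
  | 0 => pure s
  | m + 1 => do
    let s ← loop m s body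
    let i ← step m
    body i s

/-- Writing a cell of a two-dimensional array. -/
def write2 {α : Type} (A : ℕ → ℕ → α) (i j : ℕ) (v : α) : ℕ → ℕ → α :=
  Function.update A i (Function.update (A i) j v)

/-- Writing a cell of a three-dimensional array. -/
def write3 {α : Type} (A : ℕ → ℕ → ℕ → α) (i j l : ℕ) (v : α) : ℕ → ℕ → ℕ → α :=
  Function.update A i (write2 (A i) j l v)

/-! ### Randomness -/

/-- The source of random numbers: a number in `[0,1]` for each possible draw. -/
abbrev Coins : Type := ℕ × ℕ × ℕ → unitInterval

/-- The draws are independent and uniform on `[0,1]`. -/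
def coinLaw : Measure Coins := Measure.infinitePi fun _ => (volume : Measure unitInterval)

/-! ### The procedure `CENTER`

Points, matrix rows and thresholds are numbered from `0`; `P i b` is coordinate `b` of point `i`.
The threshold number `s` is `t_s = (1+δ)^s`, for `0 ≤ s ≤ L = ⌈log_{1+δ} d⌉`. -/

/-- `k = ⌈K log n / δ²⌉`. -/
def sketchLength (K n : ℕ) (δ : ℝ) : Timed ℕ := do
  let x ← step (Real.log n)
  let x ← step (K * x)
  let y ← step (δ * δ)
  let x ← step (x / y)
  step ⌈x⌉₊

/-- `L = ⌈log_{1+δ} d⌉`. -/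
def lastThreshold (d : ℕ) (δ : ℝ) : Timed ℕ := do
  let x ← step (Real.log d)
  let y ← step (1 + δ)
  let y ← step (Real.log y)
  let x ← step (x / y)
  step ⌈x⌉₊

/-- The array of the thresholds `1, 1+δ, …, (1+δ)^L`. -/
def thresholds (L : ℕ) (δ : ℝ) : Timed (ℕ → ℝ) := do
  let q ← step (1 + δ)
  let m ← step (L + 1)
  let r ← loop m ((fun _ => 0 : ℕ → ℝ), (1 : ℝ)) fun s (A, t) => do
    let A ← step (Function.update A s t)
    let t ← step (t * q)
    pure (A, t)
  pure r.1

/-- The array of the numbers `(C₁(t) + δ/30) k` for the thresholds `t`, where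
`C₁(t) = (1 - (1 - 1/(2t))^t) / 2`. -/
def cutoffs (L k : ℕ) (δ : ℝ) (ts : ℕ → ℝ) : Timed (ℕ → ℝ) := do
  let e ← step (δ / 30)
  let m ← step (L + 1)
  loop m (fun _ => 0 : ℕ → ℝ) fun s A => do
    let t ← step (ts s)
    let x ← step (2 * t)
    let x ← step (1 / x)
    let x ← step (1 - x)
    let x ← step (x ^ t)
    let x ← step (1 - x)
    let x ← step (x / 2)
    let x ← step (x + e)
    let x ← step (x * k)
    step (Function.update A s x)

/-- The random `k × d` matrices `F_t`: the entries are independent, and `1` with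
probability `1/(4t)`. -/
def randomMatrices (L k d : ℕ) (ts : ℕ → ℝ) (ω : Coins) : Timed (ℕ → ℕ → ℕ → Bool) := do
  let m ← step (L + 1)
  loop m (fun _ _ _ => false) fun s F => do
    let t ← step (ts s)
    let x ← step (4 * t)
    let x ← step (1 / x)
    loop k F fun a F =>
      loop d F fun b F => do
        let u ← step (ω (s, a, b) : ℝ)
        let bit ← step (decide (u ≤ x))
        step (write3 F s a b bit)

/-- `f_t(p_i) = F_t p_iᵀ mod 2`, for all points and all thresholds: entry `(i, s, a)` of the
result is coordinate `a` of `f_t(p_i)` for the threshold `t` number `s`. -/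
def sketches (n L k d : ℕ) (P : ℕ → ℕ → Bool) (F : ℕ → ℕ → ℕ → Bool) :
    Timed (ℕ → ℕ → ℕ → Bool) := do
  let m ← step (L + 1)
  loop n (fun _ _ _ => false) fun i G =>
    loop m G fun s G =>
      loop k G fun a G => do
        let v ← loop d false fun b v => do
          let x ← step (F s a b)
          let y ← step (P i b)
          let z ← step (x && y)
          step (v ^^ z)
        step (write3 G i s a v)

/-- The test `ham(f_t(p_i), f_t(p_j)) ≤ (C₁(t) + δ/30) k` for the threshold `t` number `s`. -/
def test (k : ℕ) (cut : ℕ → ℝ) (G : ℕ → ℕ → ℕ → Bool) (i j s : ℕ) : Timed Bool := do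
  let h ← loop k 0 fun a h => do
    let x ← step (G i s a)
    let y ← step (G j s a)
    let z ← step (x ^^ y)
    if z then step (h + 1) else pure h
  let c ← step (cut s)
  step (decide ((h : ℝ) ≤ c))

/-- Binary search in `lo, …, hi` for the smallest number that passes the test `q`.
(`fuel` only bounds the recursion depth, and `hi - lo` is always enough.) -/
def search (q : ℕ → Timed Bool) (fuel lo hi : ℕ) : Timed ℕ :=
  match fuel with
  | 0 => pure lo
  | fuel + 1 => do
    let more ← step (decide (lo < hi))
    if more then
      let x ← step (lo + hi)
      let mid ← step (x / 2)
      let ok ← q mid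
      if ok then search q fuel lo mid
      else
        let mid' ← step (mid + 1)
        search q fuel mid' hi
    else pure lo

/-- The approximate distance `W_ij`: the smallest threshold that passes the test, found by
binary search. -/
def approxDist (L k : ℕ) (ts cut : ℕ → ℝ) (G : ℕ → ℕ → ℕ → Bool) (i j : ℕ) : Timed ℝ := do
  let s ← search (test k cut G i j) L 0 L
  step (ts s)

/-- The variables of the main loop: `cen r` is the index of the center number `r`, `inT i` says
whether point `i` is a center, `minW i` is the smallest `W`-distance of point `i` (not a center)
from a center, and `lab i` is the number of a center where it is attained (its own number, if
point `i` is a center). -/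
structure Vars where
  cen : ℕ → ℕ
  inT : ℕ → Bool
  minW : ℕ → ℝ
  lab : ℕ → ℕ

/-- The set of centers is `{p_0}`, and the `W`-distances from it are computed. -/
def firstCenter (n : ℕ) (W : ℕ → ℕ → Timed ℝ) : Timed Vars := do
  let cen ← step (Function.update (fun _ => 0) 0 0 : ℕ → ℕ)
  let lab ← step (Function.update (fun _ => 0) 0 0 : ℕ → ℕ)
  let inT ← loop n (fun _ => false : ℕ → Bool) fun j A => step (Function.update A j false)
  let inT ← step (Function.update inT 0 true)
  loop n ⟨cen, inT, fun _ => 0, lab⟩ fun j v => do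
    let c ← step (v.inT j)
    if c then pure v
    else
      let w ← W 0 j
      let minW ← step (Function.update v.minW j w)
      let lab ← step (Function.update v.lab j 0)
      pure ⟨v.cen, v.inT, minW, lab⟩

/-- A point outside the set of centers with the largest `W`-distance from it (all
`W`-distances are positive). -/
def farthest (n : ℕ) (v : Vars) : Timed ℕ := do
  let r ← loop n ((0 : ℕ), (0 : ℝ)) fun j (best, x) => do
    let c ← step (v.inT j)
    if c then pure (best, x)
    else
      let w ← step (v.minW j)
      let larger ← step (decide (x < w))
      if larger then pure (j, w) else pure (best, x)
  pure r.1

/-- Point `m` becomes center number `r`, and the distances and labels of the other points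
are updated. -/
def addCenter (n : ℕ) (W : ℕ → ℕ → Timed ℝ) (v : Vars) (r m : ℕ) : Timed Vars := do
  let cen ← step (Function.update v.cen r m)
  let inT ← step (Function.update v.inT m true)
  let lab ← step (Function.update v.lab m r)
  loop n ⟨cen, inT, v.minW, lab⟩ fun j v => do
    let c ← step (v.inT j)
    if c then pure v
    else
      let w ← W m j
      let x ← step (v.minW j)
      let smaller ← step (decide (w < x))
      if smaller then
        let minW ← step (Function.update v.minW j w)
        let lab ← step (Function.update v.lab j r)
        pure ⟨v.cen, v.inT, minW, lab⟩
      else pure v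

/-- `CENTER(ℓ, P, δ)` on the points `P 0, …, P (n-1)` of `{0,1}^d`, where `K` is the constant in
`k = O(log n / δ²)`. It returns the centers `cen 0, …, cen (ℓ-1)` and the labels `lab` of the
induced clustering. -/
def center (K ℓ n d : ℕ) (P : ℕ → ℕ → Bool) (δ : ℝ) (ω : Coins) : Timed Vars := do
  let k ← sketchLength K n δ
  let L ← lastThreshold d δ
  let ts ← thresholds L δ
  let cut ← cutoffs L k δ ts
  let F ← randomMatrices L k d ts ω
  let G ← sketches n L k d P F
  let v ← firstCenter n (approxDist L k ts cut G)
  let m ← step (ℓ - 1)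
  loop m v fun i v => do
    let r ← step (i + 1)
    let far ← farthest n v
    addCenter n (approxDist L k ts cut G) v r far

/-- The input array of the points `p i`. -/
def inputArray {n d : ℕ} (p : Fin n → Cube d) (i b : ℕ) : Bool :=
  if h : i < n ∧ b < d then p ⟨i, h.1⟩ ⟨b, h.2⟩ else false

/-- The procedure is run on `p`, `ℓ`, `δ` with the constant `K` and the random numbers `ω`. -/
def run {n d : ℕ} (K ℓ : ℕ) (p : Fin n → Cube d) (δ : ℝ) (ω : Coins) : Timed Vars :=
  center K ℓ n d (inputArray p) δ ω

/-- The returned centers are `ℓ` input points that form a `ρ`-approximate solution of the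
`ℓ`-center problem, and the returned clustering, which puts each center into the cluster of its own
number, is a `ρ`-approximate solution of the minimum-diameter `ℓ`-clustering problem. -/
def Succeeds {n d : ℕ} (ℓ : ℕ) (p : Fin n → Cube d) (ρ : ℝ) (out : Vars) : Prop :=
  ∃ (c : Fin ℓ → Fin n) (g : Fin n → Fin ℓ),
    (∀ r : Fin ℓ, out.cen r = c r) ∧ (∀ i : Fin n, out.lab i = g i) ∧ (∀ r, g (c r) = r) ∧
    IsCenterApprox p ℓ ρ (Finset.univ.image fun r => p (c r)) ∧
    IsDiamApprox p ρ g

end HammingCluster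

end

/-! Running time: all costs are sums over nested loops. Two terms dominate: computing the sketches
takes about `n (L+1) k d` steps, and there are `O(n ℓ)` evaluations of `W`, each a binary search
with `O(log L)` tests of `O(k)` steps.

Correctness of one test: fix two points at distance `h` and a threshold `t`. As the sketch is linear
mod 2, two sketches differ in a coordinate exactly when a random row has odd product with the sum of
the points. Parity written as a sign is a product of independent factors, so this has probability
`oddProb t h`, which increases with `h`. The cutoff lies slightly above `oddProb t t`, so by
Hoeffding's inequality the test very likely passes if `h ≤ t` and fails if `h ≥ (1+δ) t`. In between
nothing is needed: if all these tests are right, every `W` is within a factor `1+δ` of the distance,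
in both directions (`approxDist_spec`).

Approximation (`Traversal.succeeds`): let `D` be the `W`-distance of the farthest point that remains
after `ℓ` centers. Each point is within `(1+δ) D` of its recorded center, while the centers and that
point are `ℓ+1` points with pairwise distances at least `D/(1+δ)`. In any competing solution two of
them share a center or a cluster. Both problems get the ratio `2 (1+δ)^2`, which is at most `2+ε`
for `δ = ε/5`.

Union bound: the number of thresholds grows like `log d / δ`, and `1/δ` is not bounded by a power of
`n`, so one polynomially small error bound for all thresholds is not enough. But a test that is `m`
threshold steps away from the distance has a margin of order `mδ/(1+mδ)`, hence error at most
`exp(-am) + exp(-a/δ)` with `a` proportional to `log n` (`exp_margin_le`). The first terms form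
geometric series; the second term beats the factor `1/δ`, and `log d ≤ n^β log 2` costs only a power
of `n` (`failure_bound`). -/

noncomputable section

namespace HammingCluster

/-! ### Values and costs of timed computations -/

namespace Timed

variable {α β : Type}

@[simp] theorem val_pure (a : α) : (pure a : Timed α).val = a := rfl
@[simp] theorem cost_pure (a : α) : (pure a : Timed α).cost = 0 := rfl
@[simp] theorem val_bind (x : Timed α) (f : α → Timed β) : (x >>= f).val = (f x.val).val := rfl
@[simp] theorem cost_bind (x : Timed α) (f : α → Timed β) :
    (x >>= f).cost = x.cost + (f x.val).cost := rfl
@[simp] theorem val_step (a : α) : (step a).val = a := rfl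
@[simp] theorem cost_step (a : α) : (step a).cost = 1 := rfl

end Timed

section Loop

variable {σ : Type}

@[simp] theorem loop_zero_val (s : σ) (body : ℕ → σ → Timed σ) : (loop 0 s body).val = s := rfl

@[simp] theorem loop_succ_val (m : ℕ) (s : σ) (body : ℕ → σ → Timed σ) :
    (loop (m + 1) s body).val = (body m (loop m s body).val).val := rfl

theorem loop_succ_cost (m : ℕ) (s : σ) (body : ℕ → σ → Timed σ) :
    (loop (m + 1) s body).cost =
      (loop m s body).cost + (1 + (body m (loop m s body).val).cost) := rfl

theorem loop_cost_le {m c : ℕ} {s : σ} {body : ℕ → σ → Timed σ}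
    (h : ∀ i x, (body i x).cost ≤ c) : (loop m s body).cost ≤ m * (c + 1) := by
  induction m with
  | zero => exact Nat.zero_le _
  | succ m ih =>
    rw [loop_succ_cost, Nat.succ_mul]
    have := h m (loop m s body).val
    omega

theorem loop_induction {m : ℕ} {s : σ} {body : ℕ → σ → Timed σ} (I : ℕ → σ → Prop)
    (h0 : I 0 s) (hs : ∀ i < m, ∀ x, I i x → I (i + 1) (body i x).val) :
    I m (loop m s body).val := by
  induction m with
  | zero => exact h0
  | succ m ih =>
    exact hs m (Nat.lt_succ_self m) _ (ih fun i hi => hs i (Nat.lt_succ_of_lt hi))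

end Loop

/-! ### The number of steps of the subroutines -/

theorem sketchLength_cost (K n : ℕ) (δ : ℝ) : (sketchLength K n δ).cost = 5 := rfl

theorem lastThreshold_cost (d : ℕ) (δ : ℝ) : (lastThreshold d δ).cost = 5 := rfl

theorem thresholds_cost_le (L : ℕ) (δ : ℝ) : (thresholds L δ).cost ≤ 2 + (L + 1) * 3 := by
  simp only [thresholds, Timed.cost_bind, Timed.cost_step, Timed.val_step, Timed.cost_pure,
    add_zero]
  grw [loop_cost_le (c := 2)]
  · omega
  · intro i x; simp

theorem cutoffs_cost_le (L k : ℕ) (δ : ℝ) (ts : ℕ → ℝ) :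
    (cutoffs L k δ ts).cost ≤ 2 + (L + 1) * 11 := by
  simp only [cutoffs, Timed.cost_bind, Timed.cost_step, Timed.val_step]
  grw [loop_cost_le (c := 10)]
  · omega
  · intro i x; simp

theorem randomMatrices_cost_le (L k d : ℕ) (ts : ℕ → ℝ) (ω : Coins) :
    (randomMatrices L k d ts ω).cost ≤ 1 + (L + 1) * (3 + k * (d * 4 + 1) + 1) := by
  simp only [randomMatrices, Timed.cost_bind, Timed.cost_step, Timed.val_step]
  grw [loop_cost_le (c := 3 + k * (d * 4 + 1))]
  intro i x
  simp only [Timed.cost_bind, Timed.cost_step]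
  grw [loop_cost_le (c := d * 4)]
  · omega
  intro a F
  exact loop_cost_le fun i x => by simp

theorem sketches_cost_le (n L k d : ℕ) (P : ℕ → ℕ → Bool) (F : ℕ → ℕ → ℕ → Bool) :
    (sketches n L k d P F).cost ≤ 1 + n * ((L + 1) * (k * (d * 5 + 1 + 1) + 1) + 1) := by
  simp only [sketches, Timed.cost_bind, Timed.cost_step, Timed.val_step]
  grw [loop_cost_le (c := (L + 1) * (k * (d * 5 + 1 + 1) + 1))]
  intro i x
  refine loop_cost_le fun s G => loop_cost_le fun a G => ?_
  simp only [Timed.cost_bind, Timed.cost_step]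
  grw [loop_cost_le (c := 4)]
  intro b v
  simp

theorem test_cost_le (k : ℕ) (cut : ℕ → ℝ) (G : ℕ → ℕ → ℕ → Bool) (i j s : ℕ) :
    (test k cut G i j s).cost ≤ k * 5 + 2 := by
  simp only [test, Timed.cost_bind, Timed.cost_step, Timed.val_step]
  grw [loop_cost_le (c := 4)]
  intro a h
  cases hz : G i s a ^^ G j s a <;> simp [hz]

/-- Each round halves the interval, so `J` bounds the number of rounds independently of the fuel.
The 4 pays for the comparison, the midpoint and the increment; the leading 1 is the last comparison.
-/
theorem search_cost_le {q : ℕ → Timed Bool} {c : ℕ} (hq : ∀ s, (q s).cost ≤ c) (fuel : ℕ) :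
    ∀ J lo hi : ℕ, hi - lo < 2 ^ J → (search q fuel lo hi).cost ≤ 1 + J * (c + 4) := by
  induction fuel with
  | zero => intro J lo hi _; exact Nat.zero_le _
  | succ fuel ih =>
    intro J lo hi h
    by_cases hlt : lo < hi
    · obtain _ | J := J
      · omega
      rw [pow_succ] at h
      have h1 := ih J lo ((lo + hi) / 2) (by omega)
      have h2 := ih J ((lo + hi) / 2 + 1) hi (by omega)
      have h3 := hq ((lo + hi) / 2)
      have h4 : (J + 1) * (c + 4) = J * (c + 4) + (c + 4) := by ring
      simp only [search, Timed.cost_bind, Timed.cost_step, Timed.val_step, decide_eq_true_eq, hlt,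
        if_true]
      cases hz : (q ((lo + hi) / 2)).val <;>
        simp only [if_true, Bool.false_eq_true, if_false, Timed.cost_bind, Timed.cost_step,
          Timed.val_step] <;> omega
    · simp [search, hlt]

theorem approxDist_cost_le {L J : ℕ} (hJ : L < 2 ^ J) (k : ℕ) (ts cut : ℕ → ℝ)
    (G : ℕ → ℕ → ℕ → Bool) (i j : ℕ) :
    (approxDist L k ts cut G i j).cost ≤ 2 + J * (k * 5 + 6) := by
  have := search_cost_le (test_cost_le k cut G i j) L J 0 L (by simpa using hJ)
  rw [show k * 5 + 2 + 4 = k * 5 + 6 by ring] at this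
  simp only [approxDist, Timed.cost_bind, Timed.cost_step]
  omega

theorem firstCenter_cost_le (n : ℕ) {W : ℕ → ℕ → Timed ℝ} {c : ℕ}
    (hW : ∀ i j, (W i j).cost ≤ c) : (firstCenter n W).cost ≤ 3 + n * (c + 6) := by
  simp only [firstCenter, Timed.cost_bind, Timed.cost_step, Timed.val_step]
  grw [loop_cost_le (c := 1), loop_cost_le (c := c + 3)]
  · linarith
  · intro j v
    have := hW 0 j
    cases v.inT j
    · simp; omega
    · simp
  · intro j v; simp

theorem farthest_cost_le (n : ℕ) (v : Vars) : (farthest n v).cost ≤ n * 4 := by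
  simp only [farthest, Timed.cost_bind, Timed.cost_pure, add_zero]
  refine loop_cost_le (c := 3) fun j x => ?_
  cases v.inT j
  · by_cases hw : x.2 < v.minW j <;> simp [hw]
  · simp

theorem addCenter_cost_le (n : ℕ) {W : ℕ → ℕ → Timed ℝ} {c : ℕ}
    (hW : ∀ i j, (W i j).cost ≤ c) (v : Vars) (r m : ℕ) :
    (addCenter n W v r m).cost ≤ 3 + n * (c + 6) := by
  simp only [addCenter, Timed.cost_bind, Timed.cost_step, Timed.val_step]
  grw [loop_cost_le (c := c + 5)]
  · linarith
  · intro j v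
    have := hW m j
    cases v.inT j
    · by_cases hw : (W m j).val < v.minW j <;> simp [hw] <;> omega
    · simp

/-! ### Total running time of the procedure -/

theorem center_cost_le {K ℓ n d L k J : ℕ} {P : ℕ → ℕ → Bool} {δ : ℝ} {ω : Coins}
    (hk : (sketchLength K n δ).val = k) (hL : (lastThreshold d δ).val = L) (hJ : L < 2 ^ J)
    (hn : 1 ≤ n) (hd : 1 ≤ d) (hℓ : 1 ≤ ℓ) :
    (center K ℓ n d P δ ω).cost ≤
      50 * (n * (L + 1) * (k + 1) * d) + 30 * (n * ℓ * (k + 1) * J) + 20 * (n * ℓ) := by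
  simp only [center, Timed.cost_bind, Timed.cost_step, sketchLength_cost, lastThreshold_cost, hk,
    hL]
  have hc : ∀ ts cut G i j, (approxDist L k ts cut G i j).cost ≤ 2 + J * (k * 5 + 6) :=
    approxDist_cost_le hJ k
  grw [thresholds_cost_le, cutoffs_cost_le, randomMatrices_cost_le, sketches_cost_le,
    firstCenter_cost_le n (hc _ _ _),
    loop_cost_le (c := 1 + n * 4 + (3 + n * (2 + J * (k * 5 + 6) + 6)))]
  -- After the positive parameters are shifted, both sides are polynomials with natural
  -- coefficients, and `omega` compares them with the monomials as atoms.
  · obtain ⟨ℓ, rfl⟩ : ∃ l, ℓ = l + 1 := ⟨ℓ - 1, by omega⟩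
    obtain ⟨n, rfl⟩ : ∃ l, n = l + 1 := ⟨n - 1, by omega⟩
    obtain ⟨d, rfl⟩ : ∃ l, d = l + 1 := ⟨d - 1, by omega⟩
    simp only [Timed.val_step, Nat.add_sub_cancel]
    ring_nf
    omega
  · intro i v
    simp only [Timed.cost_bind, Timed.cost_step]
    grw [farthest_cost_le, addCenter_cost_le n (hc _ _ _)]
    omega

/-- The value 3 exceeds `e`, so the iterated logarithm in the time bound is at least 1 and additive
constants can be absorbed into it. -/
theorem logb_one_add_ge {δ : ℝ} (h0 : 0 < δ) (h1 : δ < 1 / 10) {d : ℕ} (hd : 2 ≤ d) :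
    3 ≤ Real.logb (1 + δ) d := by
  have hl : 0 < Real.log (1 + δ) := Real.log_pos (by linarith)
  have hl' : Real.log (1 + δ) ≤ 1 / 10 := by
    have := Real.log_le_sub_one_of_pos (show 0 < 1 + δ by linarith)
    linarith
  have hd' : Real.log 2 ≤ Real.log d := Real.log_le_log (by norm_num) (by exact_mod_cast hd)
  have := Real.log_two_gt_d9
  rw [Real.logb, le_div_iff₀ hl]
  linarith

theorem run_cost_le (K : ℕ) {n d ℓ : ℕ} (p : Fin n → Cube d) {ε : ℝ} (hℓ : 1 ≤ ℓ)
    (hn : 2 ≤ n) (h0 : 0 < ε) (h1 : ε < 1 / 2) (hd : 2 ≤ d) (ω : Coins) :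
    ((run K ℓ p (ε / 5) ω).cost : ℝ) ≤
      140 * (25 * K + 2) * (n * Real.log n *
        (d * Real.logb (1 + ε / 5) d + ℓ * Real.log (Real.logb (1 + ε / 5) d)) / ε ^ 2) := by
  set M := Real.logb (1 + ε / 5) d with hM
  have hM3 : 3 ≤ M := logb_one_add_ge (by linarith) (by linarith) hd
  set A := Real.log n / ε ^ 2 with hA
  have hA1 : 1 ≤ A := by
    have hn' : Real.log 2 ≤ Real.log n := Real.log_le_log (by norm_num) (by exact_mod_cast hn)
    have := Real.log_two_gt_d9
    rw [hA, le_div_iff₀ (by positivity)]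
    nlinarith
  set k := (sketchLength K n (ε / 5)).val with hk
  set L := (lastThreshold d (ε / 5)).val with hL
  have hkA : (k : ℝ) + 1 ≤ (25 * K + 2) * A := by
    have hx : k = ⌈25 * K * A⌉₊ := by
      simp only [hk, sketchLength, Timed.val_bind, Timed.val_step, hA]
      congr 1
      field_simp
      norm_num
    have := Nat.ceil_lt_add_one (show 0 ≤ 25 * K * A by positivity)
    rw [hx]
    linarith
  have hLM : (L : ℝ) + 1 ≤ 2 * M := by
    have := Nat.ceil_lt_add_one (show 0 ≤ M by linarith)
    change (⌈M⌉₊ : ℝ) + 1 ≤ 2 * M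
    linarith
  have hL0 : (1 : ℝ) ≤ L := by
    have : M ≤ L := Nat.le_ceil M
    linarith
  have hlam : 1 ≤ Real.log M := by
    rw [Real.le_log_iff_exp_le (by linarith)]
    linarith [Real.exp_one_lt_d9]
  set J := Nat.log 2 L + 1 with hJ
  have hJM : (J : ℝ) ≤ 4 * Real.log M := by
    have h2 := Real.log_two_gt_d9
    have e1 : (Nat.log 2 L : ℝ) ≤ Real.log L / Real.log 2 := Real.natLog_le_logb L 2
    have e2 : Real.log L ≤ Real.log 2 + Real.log M := by
      rw [← Real.log_mul (by norm_num) (by linarith)]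
      exact Real.log_le_log (by linarith) (by linarith)
    have e3 : Real.log L / Real.log 2 ≤ 1 + 2 * Real.log M := by
      rw [div_le_iff₀ (by linarith)]
      nlinarith
    rw [hJ]
    push_cast
    linarith
  have hcost : (run K ℓ p (ε / 5) ω).cost ≤ _ :=
    center_cost_le hk.symm hL.symm (Nat.lt_pow_succ_log_self (by norm_num) L) (by omega)
      (by omega) hℓ
  have hcost' : ((run K ℓ p (ε / 5) ω).cost : ℝ) ≤
      50 * (n * (L + 1) * (k + 1) * d) + 30 * (n * ℓ * (k + 1) * J) + 20 * (n * ℓ) := by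
    exact_mod_cast hcost
  have hR : n * Real.log n * (d * M + ℓ * Real.log M) / ε ^ 2 =
      A * (n * d * M) + A * (n * ℓ * Real.log M) := by rw [hA]; ring
  rw [hR]
  have t1 : (n * (L + 1) * (k + 1) * d : ℝ) ≤ n * (2 * M) * ((25 * K + 2) * A) * d := by
    gcongr
  have t2 : (n * ℓ * (k + 1) * J : ℝ) ≤ n * ℓ * ((25 * K + 2) * A) * (4 * Real.log M) := by
    gcongr
  have t3 : (n * ℓ : ℝ) ≤ n * ℓ * ((25 * K + 2) * (A * Real.log M)) :=
    le_mul_of_one_le_right (by positivity) (by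
      have : 1 ≤ A * Real.log M := one_le_mul_of_one_le_of_one_le hA1 hlam
      have hK : (0 : ℝ) ≤ K := by positivity
      nlinarith)
  have t4 : (0 : ℝ) ≤ n * M * ((25 * K + 2) * A) * d := by positivity
  -- The constant 140 is the larger of `50 * 2` for the `d`-term and `30 * 4 + 20` for the `ℓ`-term.
  calc _ ≤ _ := hcost'
    _ ≤ 50 * (n * (2 * M) * ((25 * K + 2) * A) * d) +
        30 * (n * ℓ * ((25 * K + 2) * A) * (4 * Real.log M)) +
        20 * (n * ℓ * ((25 * K + 2) * (A * Real.log M))) := by gcongr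
    _ ≤ _ := by linarith

/-! ### The arrays computed by the subroutines -/

theorem loop_update_val {α : Type} {m : ℕ} {A : ℕ → α} {body : ℕ → (ℕ → α) → Timed (ℕ → α)}
    {f : ℕ → α} (h : ∀ s B, (body s B).val = Function.update B s (f s)) (s : ℕ) :
    (loop m A body).val s = if s < m then f s else A s := by
  induction m with
  | zero => simp
  | succ m ih =>
    rw [loop_succ_val, h]
    by_cases hs : s = m
    · subst hs; simp
    · rw [Function.update_of_ne hs, ih]
      have : s < m + 1 ↔ s < m := by omega
      simp [this]

theorem write3_apply {α : Type} (A : ℕ → ℕ → ℕ → α) (i j l : ℕ) (v : α) (i' j' l' : ℕ) :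
    write3 A i j l v i' j' l' = if i' = i ∧ j' = j ∧ l' = l then v else A i' j' l' := by
  by_cases hi : i' = i
  · subst hi
    by_cases hj : j' = j
    · subst hj
      by_cases hl : l' = l
      · subst hl; simp [write3, write2]
      · simp [write3, write2, hl]
    · simp [write3, write2, hj]
  · simp [write3, hi]

/-- Each cell in range is written exactly once, so its initial value is irrelevant. The bodies are
constrained only through their values, which leaves room for counted steps around the inner loops.
-/
theorem loop_write3_val {α : Type} {n m k : ℕ} {A : ℕ → ℕ → ℕ → α} {f : ℕ → ℕ → ℕ → α}
    {body₁ : ℕ → (ℕ → ℕ → ℕ → α) → Timed (ℕ → ℕ → ℕ → α)}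
    {body₂ : ℕ → ℕ → (ℕ → ℕ → ℕ → α) → Timed (ℕ → ℕ → ℕ → α)}
    {body₃ : ℕ → ℕ → ℕ → (ℕ → ℕ → ℕ → α) → Timed (ℕ → ℕ → ℕ → α)}
    (h₁ : ∀ i B, (body₁ i B).val = (loop m B (body₂ i)).val)
    (h₂ : ∀ i j B, (body₂ i j B).val = (loop k B (body₃ i j)).val)
    (h₃ : ∀ i j l B, (body₃ i j l B).val = write3 B i j l (f i j l))
    {i j l : ℕ} (hi : i < n) (hj : j < m) (hl : l < k) :
    (loop n A body₁).val i j l = f i j l := by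
  have e₃ : ∀ k i j B i' j' l', (loop k B (body₃ i j)).val i' j' l' =
      if i' = i ∧ j' = j ∧ l' < k then f i j l' else B i' j' l' := by
    intro k i j B i' j' l'
    induction k with
    | zero => simp
    | succ k ih => rw [loop_succ_val, h₃, write3_apply, ih]; grind
  have e₂ : ∀ m i B i' j' l', (loop m B (body₂ i)).val i' j' l' =
      if i' = i ∧ j' < m ∧ l' < k then f i j' l' else B i' j' l' := by
    intro m i B i' j' l'
    induction m with
    | zero => simp
    | succ m ih => rw [loop_succ_val, h₂, e₃, ih]; grind
  have e₁ : ∀ n i' j' l', (loop n A body₁).val i' j' l' =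
      if i' < n ∧ j' < m ∧ l' < k then f i' j' l' else A i' j' l' := by
    intro n i' j' l'
    induction n with
    | zero => simp
    | succ n ih => rw [loop_succ_val, h₁, e₂, ih]; grind
  rw [e₁, if_pos ⟨hi, hj, hl⟩]

theorem thresholds_val {L s : ℕ} (δ : ℝ) (hs : s ≤ L) :
    (thresholds L δ).val s = (1 + δ) ^ s := by
  have := loop_induction (m := L + 1) (s := ((fun _ => 0 : ℕ → ℝ), (1 : ℝ)))
    (body := fun s (A, t) => do
      let A ← step (Function.update A s t)
      let t ← step (t * (1 + δ))
      pure (A, t))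
    (fun m r => r.2 = (1 + δ) ^ m ∧ ∀ s < m, r.1 s = (1 + δ) ^ s) (by simp) (by
      rintro i - ⟨A, t⟩ ⟨rfl, hA⟩
      refine ⟨(pow_succ _ _).symm, fun s hs => ?_⟩
      simp only [Timed.val_bind, Timed.val_step, Timed.val_pure]
      by_cases h : s = i
      · subst h; simp
      · rw [Function.update_of_ne h]; exact hA s (by omega))
  exact this.2 s (by omega)

/-- The probability of an odd number of ones among `h` independent bits that are `1` with
probability `1 / (4t)`. -/
def oddProb (t h : ℝ) : ℝ := (1 - (1 - 1 / (2 * t)) ^ h) / 2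

theorem cutoffs_val {L s : ℕ} (k : ℕ) (δ : ℝ) (ts : ℕ → ℝ) (hs : s ≤ L) :
    (cutoffs L k δ ts).val s = (oddProb (ts s) (ts s) + δ / 30) * k := by
  simp only [cutoffs, Timed.val_bind, Timed.val_step]
  rw [loop_update_val (f := fun s => (oddProb (ts s) (ts s) + δ / 30) * k) (fun s B => rfl),
    if_pos (by omega)]

theorem randomMatrices_val {L k d s a b : ℕ} (ts : ℕ → ℝ) (ω : Coins) (hs : s ≤ L) (ha : a < k)
    (hb : b < d) :
    (randomMatrices L k d ts ω).val s a b = decide ((ω (s, a, b) : ℝ) ≤ 1 / (4 * ts s)) := by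
  simp only [randomMatrices, Timed.val_bind, Timed.val_step]
  let body₃ : ℕ → ℕ → ℕ → (ℕ → ℕ → ℕ → Bool) → Timed (ℕ → ℕ → ℕ → Bool) := fun s a b F => do
    let u ← step (ω (s, a, b) : ℝ)
    let bit ← step (decide (u ≤ 1 / (4 * ts s)))
    step (write3 F s a b bit)
  refine loop_write3_val (body₂ := fun s a F => loop d F (body₃ s a)) (body₃ := body₃)
    (f := fun s a b => decide ((ω (s, a, b) : ℝ) ≤ 1 / (4 * ts s)))
    ?_ ?_ ?_ (Nat.lt_succ_of_le hs) ha hb <;> intros <;> rfl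

/-- The sign `(-1)^b` of a bit `b`. -/
def sign (b : Bool) : ℝ := if b then -1 else 1

theorem sign_xor (a b : Bool) : sign (a ^^ b) = sign a * sign b := by
  cases a <;> cases b <;> simp [sign]

theorem sign_sketches {n L k d i s a : ℕ} (P : ℕ → ℕ → Bool) (F : ℕ → ℕ → ℕ → Bool)
    (hi : i < n) (hs : s ≤ L) (ha : a < k) :
    sign ((sketches n L k d P F).val i s a) = ∏ b ∈ Finset.range d, sign (F s a b && P i b) := by
  simp only [sketches, Timed.val_bind, Timed.val_step]
  rw [loop_write3_val (fun _ _ => rfl) (fun _ _ _ => rfl) (fun _ _ _ _ => rfl) hi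
    (Nat.lt_succ_of_le hs) ha]
  induction d with
  | zero => simp [sign]
  | succ d ih =>
    rw [loop_succ_val, Finset.prod_range_succ, ← ih, ← sign_xor]
    simp

theorem test_val (k : ℕ) (cut : ℕ → ℝ) (G : ℕ → ℕ → ℕ → Bool) (i j s : ℕ) :
    (test k cut G i j s).val =
      decide (∑ a ∈ Finset.range k, (1 - sign (G i s a) * sign (G j s a)) / 2 ≤ cut s) := by
  simp only [test, Timed.val_bind, Timed.val_step]
  congr 2
  refine loop_induction (I := fun k (h : ℝ) => h =
    ∑ a ∈ Finset.range k, (1 - sign (G i s a) * sign (G j s a)) / 2) ?_ ?_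
  · simp
  · rintro a - h rfl
    rw [Finset.sum_range_succ, ← sign_xor]
    cases hz : G i s a ^^ G j s a <;> simp [hz, sign]

/-- The number of rows of the random matrix number `s` whose product with `x + y` is odd. -/
def oddRows (k d s : ℕ) (t : ℝ) (x y : ℕ → Bool) (ω : Coins) : ℝ :=
  ∑ a ∈ Finset.range k, (1 - ∏ b ∈ Finset.range d,
    sign (decide ((ω (s, a, b) : ℝ) ≤ 1 / (4 * t)) && (x b ^^ y b))) / 2

/-- Linearity mod 2: the sum of two sketches is the sketch of the sum, so the test depends on the
two points only through their xor. -/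
theorem test_sketches_val {n L k d i j s : ℕ} (P : ℕ → ℕ → Bool) (ts cut : ℕ → ℝ) (ω : Coins)
    (hi : i < n) (hj : j < n) (hs : s ≤ L) :
    (test k cut (sketches n L k d P (randomMatrices L k d ts ω).val).val i j s).val =
      decide (oddRows k d s (ts s) (P i) (P j) ω ≤ cut s) := by
  rw [test_val, oddRows]
  congr 2
  refine Finset.sum_congr rfl fun a ha => ?_
  rw [Finset.mem_range] at ha
  rw [sign_sketches _ _ hi hs ha, sign_sketches _ _ hj hs ha, ← Finset.prod_mul_distrib]
  congr 2
  refine Finset.prod_congr rfl fun b hb => ?_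
  rw [← sign_xor, randomMatrices_val ts ω hs ha (Finset.mem_range.1 hb)]
  rw [Bool.and_xor_distrib_left]

/-! ### Binary search -/

/-- Monotonicity of `q` is not assumed, since random tests need not be monotone. What survives is
local: the result passes or is the upper end, and its predecessor fails or the result is the lower
end. -/
theorem search_spec (q : ℕ → Timed Bool) (fuel : ℕ) :
    ∀ lo hi : ℕ, lo ≤ hi → hi - lo ≤ fuel → ∃ s, (search q fuel lo hi).val = s ∧
      lo ≤ s ∧ s ≤ hi ∧ (s = hi ∨ (q s).val = true) ∧
      (s = lo ∨ 0 < s ∧ (q (s - 1)).val = false) := by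
  induction fuel with
  | zero =>
    intro lo hi h h'
    exact ⟨lo, rfl, le_refl _, h, Or.inl (by omega), Or.inl rfl⟩
  | succ fuel ih =>
    intro lo hi h h'
    by_cases hlt : lo < hi
    · simp only [search, Timed.val_bind, Timed.val_step, decide_eq_true_eq, hlt, if_true]
      cases hq : (q ((lo + hi) / 2)).val
      · obtain ⟨s, hs, h1, h2, h3, h4⟩ := ih ((lo + hi) / 2 + 1) hi (by omega) (by omega)
        refine ⟨s, by simpa using hs, by omega, h2, h3, Or.inr ?_⟩
        rcases h4 with rfl | h4
        · exact ⟨by omega, by simpa using hq⟩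
        · exact h4
      · obtain ⟨s, hs, h1, h2, h3, h4⟩ := ih lo ((lo + hi) / 2) (by omega) (by omega)
        refine ⟨s, by simpa using hs, h1, by omega, Or.inr ?_, h4⟩
        rcases h3 with rfl | h3
        · exact hq
        · exact h3
    · exact ⟨lo, by simp [search, hlt], le_refl _, h, Or.inl (by omega), Or.inl rfl⟩

/-- A result with `(1+δ) t < h` would have failed its test, and one with `t > (1+δ) h` would have a
predecessor that passes. At the two ends of the search range, `1 ≤ h` and `h ≤ (1+δ)^L` replace
these arguments. -/
theorem approxDist_spec {L k : ℕ} {δ h : ℝ} {ts cut : ℕ → ℝ} {G : ℕ → ℕ → ℕ → Bool} {i j : ℕ}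
    (hδ : 0 ≤ δ) (h1 : 1 ≤ h) (hL : h ≤ (1 + δ) ^ L) (hts : ∀ s ≤ L, ts s = (1 + δ) ^ s)
    (hpass : ∀ s ≤ L, h ≤ (1 + δ) ^ s → (test k cut G i j s).val = true)
    (hfail : ∀ s ≤ L, (1 + δ) ^ (s + 1) ≤ h → (test k cut G i j s).val = false) :
    0 < (approxDist L k ts cut G i j).val ∧ (approxDist L k ts cut G i j).val ≤ (1 + δ) * h ∧
      h ≤ (1 + δ) * (approxDist L k ts cut G i j).val := by
  obtain ⟨s, hs, -, h2, h3, h4⟩ := search_spec (test k cut G i j) L 0 L (by omega) (by omega)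
  have hval : (approxDist L k ts cut G i j).val = (1 + δ) ^ s := by
    simp only [approxDist, Timed.val_bind, Timed.val_step]
    rw [hs, hts s h2]
  rw [hval]
  refine ⟨by positivity, ?_, ?_⟩
  · rcases h4 with rfl | ⟨h4, h5⟩
    · rw [pow_zero]; nlinarith
    · by_contra! hc
      have := hpass (s - 1) (by omega) (by
        obtain ⟨s, rfl⟩ : ∃ r, s = r + 1 := ⟨s - 1, by omega⟩
        rw [pow_succ, mul_comm] at hc
        exact (lt_of_mul_lt_mul_right hc (by positivity)).le.trans_eq (by simp))
      rw [h5] at this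
      cases this
  · by_contra! hc
    rcases h3 with rfl | h3
    · have : (1 + δ) ^ s ≤ (1 + δ) * (1 + δ) ^ s :=
        le_mul_of_one_le_left (by positivity) (by linarith)
      linarith
    · rw [hfail s h2 (by rw [pow_succ']; exact hc.le)] at h3
      cases h3

/-! ### Farthest-point traversal -/

theorem farthest_spec {n : ℕ} {v : Vars} (hpos : ∀ j < n, v.inT j = false → 0 < v.minW j)
    (hex : ∃ j < n, v.inT j = false) :
    ∃ m, (farthest n v).val = m ∧ m < n ∧ v.inT m = false ∧
      ∀ j < n, v.inT j = false → v.minW j ≤ v.minW m := by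
  refine ⟨_, rfl, ?_⟩
  simp only [farthest, Timed.val_bind, Timed.val_pure]
  set r := (loop n ((0 : ℕ), (0 : ℝ)) fun j (best, x) => do
    let c ← step (v.inT j)
    if c then pure (best, x)
    else
      let w ← step (v.minW j)
      let larger ← step (decide (x < w))
      if larger then pure (j, w) else pure (best, x)).val with hr
  -- The scan starts with the dummy pair `(0, 0)`. A positive maximum certifies that the stored
  -- index is a real candidate, which is why `hpos` is needed.
  have key : (∀ j < n, v.inT j = false → v.minW j ≤ r.2) ∧
      (0 < r.2 → r.1 < n ∧ v.inT r.1 = false ∧ v.minW r.1 = r.2) := by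
    refine loop_induction (fun k (r : ℕ × ℝ) => (∀ j < k, v.inT j = false → v.minW j ≤ r.2) ∧
      (0 < r.2 → r.1 < n ∧ v.inT r.1 = false ∧ v.minW r.1 = r.2)) (by simp) ?_
    rintro i hi ⟨best, x⟩ ⟨h1, h2⟩
    cases hc : v.inT i
    · by_cases hw : x < v.minW i
      · simp only [Timed.val_bind, Timed.val_step, hc, Bool.false_eq_true, if_false,
          decide_eq_true_eq, hw, if_true, Timed.val_pure]
        refine ⟨fun j hj hT => ?_, fun _ => ⟨hi, trivial, trivial⟩⟩
        rcases Nat.lt_succ_iff_lt_or_eq.1 hj with hj | rfl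
        · exact (h1 j hj hT).trans hw.le
        · exact le_refl _
      · simp only [Timed.val_bind, Timed.val_step, Bool.false_eq_true, if_false,
          decide_eq_true_eq, hw, Timed.val_pure]
        refine ⟨fun j hj hT => ?_, h2⟩
        rcases Nat.lt_succ_iff_lt_or_eq.1 hj with hj | rfl
        · exact h1 j hj hT
        · exact not_lt.1 hw
    · simp only [Timed.val_bind, Timed.val_step, if_true, Timed.val_pure]
      refine ⟨fun j hj hT => ?_, h2⟩
      rcases Nat.lt_succ_iff_lt_or_eq.1 hj with hj | rfl
      · exact h1 j hj hT
      · rw [hc] at hT; cases hT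
  obtain ⟨j, hj, hT⟩ := hex
  obtain ⟨k1, k2, k3⟩ := key.2 ((hpos j hj hT).trans_le (key.1 j hj hT))
  exact ⟨k1, k2, fun j hj hT => k3 ▸ key.1 j hj hT⟩

theorem addCenter_val (n : ℕ) (W : ℕ → ℕ → Timed ℝ) (v : Vars) (r m : ℕ) :
    ∃ v', (addCenter n W v r m).val = v' ∧ v'.cen = Function.update v.cen r m ∧
      v'.inT = Function.update v.inT m true ∧
      (∀ j < n, v'.inT j = true → v'.lab j = Function.update v.lab m r j) ∧
      ∀ j < n, v'.inT j = false → v'.minW j = min (v.minW j) (W m j).val ∧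
        v'.lab j = if (W m j).val < v.minW j then r else v.lab j := by
  refine ⟨_, rfl, ?_⟩
  simp only [addCenter, Timed.val_bind, Timed.val_step]
  -- The loop consults the updated membership array, so the new center itself is skipped and keeps
  -- its label `r`.
  set T := Function.update v.inT m true
  set w := fun j => (W m j).val
  obtain ⟨h1, h2, h3, h4⟩ := loop_induction (m := n)
    (s := ⟨Function.update v.cen r m, T, v.minW, Function.update v.lab m r⟩)
    (body := fun j (v : Vars) => do
      let c ← step (v.inT j)
      if c then pure v
      else
        let w ← W m j
        let x ← step (v.minW j)
        let smaller ← step (decide (w < x))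
        if smaller then
          let minW ← step (Function.update v.minW j w)
          let lab ← step (Function.update v.lab j r)
          pure ⟨v.cen, v.inT, minW, lab⟩
        else pure v)
    (fun i x => x.cen = Function.update v.cen r m ∧ x.inT = T ∧
      (∀ j, x.minW j = if j < i ∧ T j = false ∧ w j < v.minW j then w j else v.minW j) ∧
      ∀ j, x.lab j = if j < i ∧ T j = false ∧ w j < v.minW j then r else
        Function.update v.lab m r j) (by simp) (by
      rintro i - ⟨cen, inT, minW, lab⟩ ⟨rfl, rfl, h3, h4⟩
      simp only at h3 h4
      cases hc : T i
      · have hi := h3 i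
        simp only [lt_irrefl, false_and, if_false] at hi
        by_cases hw : w i < v.minW i
        · have hw' : (W m i).val < minW i := hi ▸ hw
          simp only [Timed.val_bind, Timed.val_step, hc, Bool.false_eq_true, if_false,
            decide_eq_true_eq, hw', if_true, Timed.val_pure]
          refine ⟨trivial, trivial, fun j => ?_, fun j => ?_⟩ <;>
          · by_cases hj : j = i
            · subst hj; simp [hc, hw, w]
            · rw [Function.update_of_ne hj]
              simp only [h3, h4, show j < i + 1 ↔ j < i by omega]
        · have hw' : ¬ (W m i).val < minW i := hi ▸ hw
          simp only [Timed.val_bind, Timed.val_step, hc, Bool.false_eq_true, if_false,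
            decide_eq_true_eq, hw', Timed.val_pure]
          refine ⟨trivial, trivial, fun j => ?_, fun j => ?_⟩ <;>
          · by_cases hj : j = i
            · subst hj; simp [h3, h4, hw]
            · simp only [h3, h4, show j < i + 1 ↔ j < i by omega]
      · simp only [Timed.val_bind, Timed.val_step, hc, if_true, Timed.val_pure]
        refine ⟨trivial, trivial, fun j => ?_, fun j => ?_⟩ <;>
        · by_cases hj : j = i
          · subst hj; simp [h3, h4, hc]
          · simp only [h3, h4, show j < i + 1 ↔ j < i by omega])
  refine ⟨h1, h2, fun j hj hT => ?_, fun j hj hT => ?_⟩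
  · rw [h2] at hT
    rw [h4, if_neg]
    rw [hT]; simp
  · rw [h2] at hT
    have hjm : j ≠ m := by rintro rfl; simp [T] at hT
    rw [h3, h4, Function.update_of_ne hjm]
    simp only [hj, hT, true_and]
    refine ⟨?_, rfl⟩
    split_ifs with h
    · exact (min_eq_right h.le).symm
    · exact (min_eq_left (not_lt.1 h)).symm

theorem firstCenter_val (n : ℕ) (W : ℕ → ℕ → Timed ℝ) :
    ∃ v, (firstCenter n W).val = v ∧ v.cen 0 = 0 ∧ (∀ j, v.inT j = true ↔ j = 0) ∧
      (∀ j, v.lab j = 0) ∧ ∀ j < n, v.inT j = false → v.minW j = (W 0 j).val := by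
  refine ⟨_, rfl, ?_⟩
  simp only [firstCenter, Timed.val_bind, Timed.val_step]
  set T := Function.update (loop n (fun _ => false : ℕ → Bool) fun j A =>
    step (Function.update A j false)).val 0 true with hT
  have hT' : ∀ j, T j = true ↔ j = 0 := by
    intro j
    by_cases hj : j = 0
    · simp [hT, hj]
    · rw [hT, Function.update_of_ne hj, loop_update_val (f := fun _ => false) (fun s B => rfl)]
      simp [hj]
  obtain ⟨h1, h2, h3, h4⟩ := loop_induction (m := n)
    (s := ⟨Function.update (fun _ => 0) 0 0, T, fun _ => 0, Function.update (fun _ => 0) 0 0⟩)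
    (body := fun j (v : Vars) => do
      let c ← step (v.inT j)
      if c then pure v
      else
        let w ← W 0 j
        let minW ← step (Function.update v.minW j w)
        let lab ← step (Function.update v.lab j 0)
        pure ⟨v.cen, v.inT, minW, lab⟩)
    (fun i x => x.cen 0 = 0 ∧ x.inT = T ∧ (∀ j, x.lab j = 0) ∧
      (∀ j < i, T j = false → x.minW j = (W 0 j).val)) (by
        refine ⟨by simp, rfl, fun j => ?_, by simp⟩
        by_cases hj : j = 0
        · simp [hj]
        · simp [Function.update_of_ne hj]) (by
      rintro i - ⟨cen, inT, minW, lab⟩ ⟨h1, rfl, h3, h4⟩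
      simp only at h1 h3 h4
      cases hc : T i
      · simp only [Timed.val_bind, Timed.val_step, hc, Bool.false_eq_true, if_false,
          Timed.val_pure]
        refine ⟨h1, trivial, fun j => ?_, fun j hj hT => ?_⟩
        · by_cases hj : j = i
          · simp [hj]
          · rw [Function.update_of_ne hj, h3]
        · by_cases hj : j = i
          · simp [hj]
          · rw [Function.update_of_ne hj, h4 j (by omega) hT]
      · simp only [Timed.val_bind, Timed.val_step, hc, if_true, Timed.val_pure]
        refine ⟨h1, trivial, h3, fun j hj hT => ?_⟩
        have : j ≠ i := by rintro rfl; rw [hc] at hT; cases hT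
        exact h4 j (by omega) hT)
  refine ⟨h1, fun j => by rw [h2]; exact hT' j, h3, fun j hj hT => ?_⟩
  rw [h2] at hT
  exact h4 j hj hT

/-- The state of the traversal with `r` centers: the centers are distinct points, every other
point knows its distance from them, and every center was at least as far from the earlier centers
as any point that is not a center. -/
structure Traversal (n : ℕ) (w : ℕ → ℕ → ℝ) (r : ℕ) (v : Vars) : Prop where
  cen_lt : ∀ q < r, v.cen q < n
  inT_iff : ∀ j < n, v.inT j = true ↔ ∃ q < r, v.cen q = j
  lab_cen : ∀ q < r, v.lab (v.cen q) = q
  lab_lt : ∀ j < n, v.inT j = false → v.lab j < r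
  minW_eq : ∀ j < n, v.inT j = false → v.minW j = w (v.cen (v.lab j)) j
  minW_le : ∀ j < n, v.inT j = false → ∀ q < r, v.minW j ≤ w (v.cen q) j
  far : ∀ q' < r, ∀ q < q', ∀ j < n, v.inT j = false → v.minW j ≤ w (v.cen q) (v.cen q')

namespace Traversal

variable {n r : ℕ} {w : ℕ → ℕ → ℝ} {v : Vars}

theorem exists_not_center (h : Traversal n w r v) (hr : r < n) : ∃ j < n, v.inT j = false := by
  by_contra! hc
  have hsub : Finset.range n ⊆ (Finset.range r).image v.cen := by
    intro j hj
    rw [Finset.mem_range] at hj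
    obtain ⟨q, hq, he⟩ := (h.inT_iff j hj).1 (by simpa using hc j hj)
    exact Finset.mem_image.2 ⟨q, Finset.mem_range.2 hq, he⟩
  have := (Finset.card_le_card hsub).trans Finset.card_image_le
  simp at this
  omega

theorem ne_of_not_center (h : Traversal n w r v) {q j : ℕ} (hq : q < r) (hj : j < n)
    (hT : v.inT j = false) : v.cen q ≠ j := by
  intro he
  rw [(h.inT_iff j hj).2 ⟨q, hq, he⟩] at hT
  cases hT

theorem exists_farthest (h : Traversal n w r v) (hr : r < n)
    (hw : ∀ i < n, ∀ j < n, i ≠ j → 0 < w i j) :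
    ∃ m, (farthest n v).val = m ∧ m < n ∧ v.inT m = false ∧
      ∀ j < n, v.inT j = false → v.minW j ≤ v.minW m := by
  refine farthest_spec (fun j hj hT => ?_) (h.exists_not_center hr)
  rw [h.minW_eq j hj hT]
  exact hw _ (h.cen_lt _ (h.lab_lt j hj hT)) _ hj (h.ne_of_not_center (h.lab_lt j hj hT) hj hT)

theorem firstCenter (hn : 0 < n) (W : ℕ → ℕ → Timed ℝ) :
    Traversal n (fun i j => (W i j).val) 1 (firstCenter n W).val := by
  obtain ⟨v, hv, h1, h2, h3, h4⟩ := firstCenter_val n W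
  rw [hv]
  refine ⟨?_, ?_, ?_, ?_, ?_, ?_, ?_⟩
  · intro q hq; obtain rfl : q = 0 := by omega
    rw [h1]; exact hn
  · intro j _; rw [h2]
    exact ⟨fun h => ⟨0, by omega, by rw [h1, h]⟩, fun ⟨q, hq, he⟩ => by
      obtain rfl : q = 0 := by omega
      rw [← he, h1]⟩
  · intro q hq; rw [h3]; omega
  · intro j _ _; rw [h3]; omega
  · intro j hj hT; rw [h3, h1, h4 j hj hT]
  · intro j hj hT q hq; obtain rfl : q = 0 := by omega
    rw [h1, h4 j hj hT]
  · intro q' hq' q hq; omega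

theorem addCenter {W : ℕ → ℕ → Timed ℝ} (h : Traversal n (fun i j => (W i j).val) r v) {m : ℕ}
    (hm : m < n) (hmT : v.inT m = false)
    (hmax : ∀ j < n, v.inT j = false → v.minW j ≤ v.minW m) :
    Traversal n (fun i j => (W i j).val) (r + 1) (addCenter n W v r m).val := by
  obtain ⟨v', hv, h1, h2, h3, h4⟩ := addCenter_val n W v r m
  rw [hv]
  have hcr : v'.cen r = m := by rw [h1]; simp
  have hcq : ∀ q < r, v'.cen q = v.cen q := fun q hq => by
    rw [h1, Function.update_of_ne (by omega)]
  have hnew : ∀ j, v'.inT j = false → v.inT j = false ∧ j ≠ m := by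
    intro j hj
    have hjm : j ≠ m := by rintro rfl; simp [h2] at hj
    rw [h2, Function.update_of_ne hjm] at hj
    exact ⟨hj, hjm⟩
  have hin : ∀ j < n, v'.inT j = true ↔ ∃ q < r + 1, v'.cen q = j := by
    intro j hj
    by_cases hjm : j = m
    · subst hjm
      simp only [h2, Function.update_self, true_iff]
      exact ⟨r, by omega, hcr⟩
    · rw [h2, Function.update_of_ne hjm, h.inT_iff j hj]
      constructor
      · rintro ⟨q, hq, he⟩; exact ⟨q, by omega, by rw [hcq q hq, he]⟩
      · rintro ⟨q, hq, he⟩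
        rcases Nat.lt_succ_iff_lt_or_eq.1 hq with hq | rfl
        · exact ⟨q, hq, by rw [← hcq q hq, he]⟩
        · exact absurd (he.symm.trans hcr) hjm
  have hlt : ∀ q < r + 1, v'.cen q < n := by
    intro q hq
    rcases Nat.lt_succ_iff_lt_or_eq.1 hq with hq | rfl
    · rw [hcq q hq]; exact h.cen_lt q hq
    · rw [hcr]; exact hm
  refine ⟨hlt, hin, ?_, ?_, ?_, ?_, ?_⟩
  · intro q hq
    rw [h3 _ (hlt q hq) ((hin _ (hlt q hq)).2 ⟨q, hq, rfl⟩)]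
    rcases Nat.lt_succ_iff_lt_or_eq.1 hq with hq | rfl
    · rw [hcq q hq, Function.update_of_ne (h.ne_of_not_center hq hm hmT), h.lab_cen q hq]
    · rw [hcr, Function.update_self]
  · intro j hj hT
    rw [(h4 j hj hT).2]
    have := h.lab_lt j hj (hnew j hT).1
    split_ifs <;> omega
  · intro j hj hT
    have hl := h.lab_lt j hj (hnew j hT).1
    have he := h.minW_eq j hj (hnew j hT).1
    rw [(h4 j hj hT).1, (h4 j hj hT).2]
    split_ifs with hw
    · rw [hcr, min_eq_right hw.le]
    · rw [hcq _ hl, min_eq_left (not_lt.1 hw), he]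
  · intro j hj hT q hq
    rw [(h4 j hj hT).1]
    rcases Nat.lt_succ_iff_lt_or_eq.1 hq with hq | rfl
    · rw [hcq q hq]
      exact (min_le_left _ _).trans (h.minW_le j hj (hnew j hT).1 q hq)
    · rw [hcr]
      exact min_le_right _ _
  · intro q' hq' q hq j hj hT
    rw [(h4 j hj hT).1]
    refine (min_le_left _ _).trans ?_
    rcases Nat.lt_succ_iff_lt_or_eq.1 hq' with hq' | rfl
    · rw [hcq q' hq', hcq q (by omega)]
      exact h.far q' hq' q hq j hj (hnew j hT).1
    · rw [hcr, hcq q hq]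
      exact (hmax j hj (hnew j hT).1).trans (h.minW_le m hm hmT q hq)

end Traversal

theorem traversal_center {K ℓ n d : ℕ} {P : ℕ → ℕ → Bool} {δ : ℝ} {ω : Coins} {k L : ℕ}
    (hℓ : 1 ≤ ℓ) (hℓn : ℓ < n)
    (hk : (sketchLength K n δ).val = k) (hL : (lastThreshold d δ).val = L) {W : ℕ → ℕ → Timed ℝ}
    (hW : W = approxDist L k (thresholds L δ).val (cutoffs L k δ (thresholds L δ).val).val
      (sketches n L k d P (randomMatrices L k d (thresholds L δ).val ω).val).val)
    (hpos : ∀ i < n, ∀ j < n, i ≠ j → 0 < (W i j).val) :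
    Traversal n (fun i j => (W i j).val) ℓ (center K ℓ n d P δ ω).val := by
  obtain ⟨ℓ, rfl⟩ : ∃ l, ℓ = l + 1 := ⟨ℓ - 1, by omega⟩
  simp only [center, Timed.val_bind, Timed.val_step, hk, hL, ← hW, Nat.add_sub_cancel]
  refine loop_induction (fun i v => Traversal n (fun i j => (W i j).val) (i + 1) v)
    (Traversal.firstCenter (by omega) W) fun i hi v hv => ?_
  obtain ⟨m, hm, h1, h2, h3⟩ := hv.exists_farthest (by omega) hpos
  simp only [Timed.val_bind, Timed.val_step, hm]
  exact hv.addCenter h1 h2 h3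

/-! ### The approximation guarantee of the traversal -/

section Guarantee

variable {n d ℓ : ℕ} {p : Fin n → Cube d}

theorem exists_hammingDist_le_radius {T : Finset (Cube d)} (hT : T.Nonempty) (i : Fin n) :
    ∃ u ∈ T, hammingDist (p i) u ≤ radius p T := by
  obtain ⟨u, hu, he⟩ := Nat.sInf_mem ((Finset.coe_nonempty.2 hT).image
    fun u => hammingDist (p i) u)
  refine ⟨u, hu, ?_⟩
  simp only at he
  rw [he]
  exact Finset.le_sup (f := fun i => sInf ((fun u => hammingDist (p i) u) '' (T : Set (Cube d))))
    (Finset.mem_univ i)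

theorem radius_le {T : Finset (Cube d)} {B : ℝ} (hB : 0 ≤ B)
    (h : ∀ i, ∃ u ∈ T, (hammingDist (p i) u : ℝ) ≤ B) : (radius p T : ℝ) ≤ B := by
  refine le_trans (Nat.cast_le.2 (Finset.sup_le fun i _ => ?_)) (Nat.floor_le hB)
  obtain ⟨u, hu, hle⟩ := h i
  exact (Nat.sInf_le (Set.mem_image_of_mem _ hu)).trans (Nat.le_floor hle)

theorem hammingDist_le_maxDiam {g : Fin n → Fin ℓ} {i j : Fin n} (h : g i = g j) :
    hammingDist (p i) (p j) ≤ maxDiam p g :=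
  Finset.le_sup (f := fun q : Fin n × Fin n => hammingDist (p q.1) (p q.2)) (b := (i, j))
    (by simpa using h)

theorem maxDiam_le {g : Fin n → Fin ℓ} {B : ℝ} (hB : 0 ≤ B)
    (h : ∀ i j, g i = g j → (hammingDist (p i) (p j) : ℝ) ≤ B) : (maxDiam p g : ℝ) ≤ B := by
  refine le_trans (Nat.cast_le.2 (Finset.sup_le fun q hq => ?_)) (Nat.floor_le hB)
  exact Nat.le_floor (h _ _ (by simpa using hq))

/-- `ℓ + 1` points that are far apart bound the radius from below. -/
theorem le_radius_of_separated {D : ℝ} {e : Option (Fin ℓ) → Fin n}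
    (he : ∀ a b, a ≠ b → D ≤ hammingDist (p (e a)) (p (e b))) (hℓ : 1 ≤ ℓ)
    {T : Finset (Cube d)} (hT : T.card = ℓ) : D ≤ 2 * radius p T := by
  have hne : T.Nonempty := Finset.card_pos.1 (by omega)
  choose f hf hle using fun a => exists_hammingDist_le_radius (p := p) hne (e a)
  obtain ⟨a, -, b, -, hab, hfab⟩ := Finset.exists_ne_map_eq_of_card_lt_of_maps_to
    (s := Finset.univ) (t := T) (f := f) (by simp [hT]) (fun a _ => hf a)
  have h1 := hle a
  have h2 := hle b
  have h3 := hammingDist_triangle (p (e a)) (f a) (p (e b))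
  rw [← hfab, hammingDist_comm] at h2
  have : hammingDist (p (e a)) (p (e b)) ≤ 2 * radius p T := by omega
  exact (he a b hab).trans (by exact_mod_cast this)

/-- `ℓ + 1` points that are far apart bound the cluster diameters from below. -/
theorem le_maxDiam_of_separated {D : ℝ} {e : Option (Fin ℓ) → Fin n}
    (he : ∀ a b, a ≠ b → D ≤ hammingDist (p (e a)) (p (e b))) (g : Fin n → Fin ℓ) :
    D ≤ maxDiam p g := by
  obtain ⟨a, b, hab, hg⟩ := Fintype.exists_ne_map_eq_of_card_lt (fun a => g (e a)) (by simp)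
  exact (he a b hab).trans (by exact_mod_cast hammingDist_le_maxDiam hg)

/-- Gonzalez's argument, with one factor `1+δ` lost when `w` bounds distances from above and another
when it bounds them from below. -/
theorem Traversal.succeeds {δ ρ : ℝ} {w : ℕ → ℕ → ℝ} {v : Vars} (hp : Function.Injective p)
    (hℓ : 1 ≤ ℓ) (hℓn : ℓ < n) (hδ : 0 ≤ δ) (hρ : 2 * (1 + δ) ^ 2 ≤ ρ)
    (hw : ∀ i j : Fin n, i ≠ j → 0 < w i j ∧ w i j ≤ (1 + δ) * hammingDist (p i) (p j) ∧
      hammingDist (p i) (p j) ≤ (1 + δ) * w i j)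
    (h : Traversal n w ℓ v) : Succeeds ℓ p ρ v := by
  have hpos : ∀ i < n, ∀ j < n, i ≠ j → 0 < w i j := fun i hi j hj hij =>
    (hw ⟨i, hi⟩ ⟨j, hj⟩ (by simpa using hij)).1
  -- This is the point that would become the next center; it serves only as the extra witness `none`
  -- in the separated family `e`.
  obtain ⟨m, -, hm, hmT, hmax⟩ := h.exists_farthest hℓn hpos
  have hlab : ∀ j < n, v.lab j < ℓ := by
    intro j hj
    cases hT : v.inT j
    · exact h.lab_lt j hj hT
    · obtain ⟨q, hq, rfl⟩ := (h.inT_iff j hj).1 hT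
      rw [h.lab_cen q hq]; exact hq
  set c : Fin ℓ → Fin n := fun r => ⟨v.cen r, h.cen_lt r r.2⟩
  set g : Fin n → Fin ℓ := fun i => ⟨v.lab i, hlab i i.2⟩
  have hgc : ∀ r, g (c r) = r := fun r => Fin.ext (h.lab_cen r r.2)
  have hcinj : Function.Injective c := fun a b hab => by rw [← hgc a, ← hgc b, hab]
  set D := v.minW m with hD
  have hδ1 : 0 < 1 + δ := by linarith
  have hD0 : 0 < D := by
    rw [hD, h.minW_eq m hm hmT]
    exact hpos _ (h.cen_lt _ (h.lab_lt m hm hmT)) _ hm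
      (h.ne_of_not_center (h.lab_lt m hm hmT) hm hmT)
  have hcover : ∀ i, (hammingDist (p i) (p (c (g i))) : ℝ) ≤ (1 + δ) * D := by
    intro i
    cases hT : v.inT i
    · have hne : c (g i) ≠ i := fun he =>
        h.ne_of_not_center (h.lab_lt i i.2 hT) i.2 hT (congrArg Fin.val he)
      have := (hw _ _ hne).2.2
      rw [hammingDist_comm]
      refine this.trans (mul_le_mul_of_nonneg_left ?_ hδ1.le)
      exact (h.minW_eq i i.2 hT).symm.trans_le (hmax i i.2 hT)
    · obtain ⟨q, hq, he⟩ := (h.inT_iff i i.2).1 hT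
      have : i = c ⟨q, hq⟩ := Fin.ext he.symm
      rw [this, hgc, hammingDist_self]
      simp only [Nat.cast_zero]
      positivity
  set e : Option (Fin ℓ) → Fin n := fun o => o.elim ⟨m, hm⟩ c
  have hcm : ∀ q, D / (1 + δ) ≤ hammingDist (p (c q)) (p ⟨m, hm⟩) := by
    intro q
    have hne : c q ≠ ⟨m, hm⟩ := fun he =>
      h.ne_of_not_center q.2 hm hmT (congrArg Fin.val he)
    rw [div_le_iff₀' hδ1]
    exact (h.minW_le m hm hmT q q.2).trans (hw _ _ hne).2.1
  have hlt : ∀ q q' : Fin ℓ, q < q' → D / (1 + δ) ≤ hammingDist (p (c q)) (p (c q')) := by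
    intro q q' hqq
    rw [div_le_iff₀' hδ1]
    exact (h.far q' q'.2 q hqq m hm hmT).trans (hw _ _ (hcinj.ne hqq.ne)).2.1
  have hsep : ∀ a b, a ≠ b → D / (1 + δ) ≤ hammingDist (p (e a)) (p (e b)) := by
    rintro (_ | q) (_ | q') hne
    · exact absurd rfl hne
    · rw [hammingDist_comm]; exact hcm q'
    · exact hcm q
    · have hne' : q ≠ q' := fun h => hne (by rw [h])
      rcases lt_or_gt_of_ne hne' with hq | hq
      · exact hlt q q' hq
      · rw [hammingDist_comm]; exact hlt q' q hq
  -- Used with `x` equal to twice the optimal radius and with `x` equal to the optimal diameter.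
  have hbound : ∀ x : ℝ, D / (1 + δ) ≤ x → 2 * ((1 + δ) * D) ≤ ρ * x := by
    intro x hx
    have hx0 : 0 ≤ x := le_trans (by positivity) hx
    rw [div_le_iff₀ hδ1] at hx
    calc 2 * ((1 + δ) * D) ≤ 2 * ((1 + δ) * (x * (1 + δ))) := by gcongr
      _ = 2 * (1 + δ) ^ 2 * x := by ring
      _ ≤ ρ * x := by gcongr
  refine ⟨c, g, fun _ => rfl, fun _ => rfl, hgc, ⟨?_, fun T' hT' => ?_⟩,
    fun r => ⟨c r, hgc r⟩, fun g' => ?_⟩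
  · exact (Finset.card_image_of_injective _ (hp.comp hcinj)).trans (by simp)
  · refine (radius_le (by positivity) fun i => ⟨p (c (g i)), ?_, hcover i⟩).trans ?_
    · exact Finset.mem_image_of_mem _ (Finset.mem_univ _)
    · have h1 := le_radius_of_separated hsep hℓ hT'
      have h2 := hbound _ h1
      linarith
  · refine (maxDiam_le (B := 2 * ((1 + δ) * D)) (by positivity) fun i j hij => ?_).trans
      (hbound _ (le_maxDiam_of_separated hsep g'))
    have h1 := hcover i
    have h2 := hcover j
    have h3 : (hammingDist (p i) (p j) : ℝ) ≤
        hammingDist (p i) (p (c (g i))) + hammingDist (p j) (p (c (g i))) := by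
      rw [hammingDist_comm (p j)]
      exact_mod_cast hammingDist_triangle _ _ _
    rw [← hij] at h2
    linarith

end Guarantee

/-- If all tests are right about the distances that are not close to their threshold, then the
procedure succeeds. -/
theorem succeeds_of_tests {K ℓ n d : ℕ} {p : Fin n → Cube d} {δ ρ : ℝ} {ω : Coins} {k L : ℕ}
    (hp : Function.Injective p) (hℓ : 1 ≤ ℓ) (hℓn : ℓ < n) (hδ : 0 ≤ δ)
    (hρ : 2 * (1 + δ) ^ 2 ≤ ρ) (hk : (sketchLength K n δ).val = k)
    (hL : (lastThreshold d δ).val = L) (hdL : (d : ℝ) ≤ (1 + δ) ^ L)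
    (hpass : ∀ i j : Fin n, i ≠ j → ∀ s ≤ L, (hammingDist (p i) (p j) : ℝ) ≤ (1 + δ) ^ s →
      oddRows k d s ((1 + δ) ^ s) (inputArray p i) (inputArray p j) ω ≤
        (oddProb ((1 + δ) ^ s) ((1 + δ) ^ s) + δ / 30) * k)
    (hfail : ∀ i j : Fin n, i ≠ j → ∀ s ≤ L, (1 + δ) ^ (s + 1) ≤ hammingDist (p i) (p j) →
      (oddProb ((1 + δ) ^ s) ((1 + δ) ^ s) + δ / 30) * k <
        oddRows k d s ((1 + δ) ^ s) (inputArray p i) (inputArray p j) ω) :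
    Succeeds ℓ p ρ (run K ℓ p δ ω).val := by
  set W := approxDist L k (thresholds L δ).val (cutoffs L k δ (thresholds L δ).val).val
      (sketches n L k d (inputArray p)
        (randomMatrices L k d (thresholds L δ).val ω).val).val with hW
  have hw : ∀ i j : Fin n, i ≠ j → 0 < (W i j).val ∧
      (W i j).val ≤ (1 + δ) * hammingDist (p i) (p j) ∧
      hammingDist (p i) (p j) ≤ (1 + δ) * (W i j).val := by
    intro i j hij
    refine approxDist_spec hδ ?_ (le_trans ?_ hdL) (fun s hs => thresholds_val δ hs) ?_ ?_
    · exact_mod_cast hammingDist_pos.2 (hp.ne hij)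
    · exact_mod_cast hammingDist_le_card_fintype.trans_eq (Fintype.card_fin d)
    · intro s hs h
      rw [test_sketches_val _ _ _ _ i.2 j.2 hs, cutoffs_val _ _ _ hs, thresholds_val δ hs]
      exact decide_eq_true (hpass i j hij s hs h)
    · intro s hs h
      rw [test_sketches_val _ _ _ _ i.2 j.2 hs, cutoffs_val _ _ _ hs, thresholds_val δ hs]
      exact decide_eq_false (not_le.2 (hfail i j hij s hs h))
  refine (traversal_center hℓ hℓn hk hL hW fun i hi j hj hij => ?_).succeeds hp hℓ hℓn hδ hρ hw
  exact (hw ⟨i, hi⟩ ⟨j, hj⟩ (by simpa using hij)).1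

open ProbabilityTheory

/-! ### The law of the number of odd rows -/

/-- The law of one row of draws. -/
def rowLaw : Measure (ℕ → unitInterval) :=
  Measure.infinitePi fun _ => (volume : Measure unitInterval)

instance : IsProbabilityMeasure rowLaw := by unfold rowLaw; infer_instance

instance : IsProbabilityMeasure coinLaw := by unfold coinLaw; infer_instance

/-- The sign of the parity of the ones of a random row at the places marked by `z`. -/
def rowSign (d : ℕ) (t : ℝ) (z : ℕ → Bool) (r : ℕ → unitInterval) : ℝ :=
  ∏ b ∈ Finset.range d, sign (decide ((r b : ℝ) ≤ 1 / (4 * t)) && z b)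

theorem measurable_sign_decide (x : ℝ) (z : Bool) :
    Measurable fun u : unitInterval => sign (decide ((u : ℝ) ≤ x) && z) := by
  have : (fun u : unitInterval => sign (decide ((u : ℝ) ≤ x) && z)) =
      fun u : unitInterval => if (u : ℝ) ≤ x then sign z else 1 := by
    ext u
    by_cases h : (u : ℝ) ≤ x <;> simp [h, sign]
  rw [this]
  exact Measurable.ite (measurableSet_le measurable_subtype_coe measurable_const)
    measurable_const measurable_const

theorem integral_sign_decide {x : ℝ} (hx : 0 ≤ x) (hx' : x ≤ 1) (z : Bool) :
    ∫ u : unitInterval, sign (decide ((u : ℝ) ≤ x) && z) = if z then 1 - 2 * x else 1 := by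
  cases z
  · simp [sign]
  · have : (fun u : unitInterval => sign (decide ((u : ℝ) ≤ x) && true)) =
        fun u : unitInterval => 1 - 2 * (Set.Iic (⟨x, hx, hx'⟩ : unitInterval)).indicator 1 u := by
      ext u
      by_cases h : (u : ℝ) ≤ x
      · rw [Set.indicator_of_mem (show u ∈ Set.Iic (⟨x, hx, hx'⟩ : unitInterval) from h)]
        simp [h, sign]
        norm_num
      · rw [Set.indicator_of_notMem (show u ∉ Set.Iic (⟨x, hx, hx'⟩ : unitInterval) from h)]
        simp [h, sign]
    rw [this, integral_sub (integrable_const _), integral_const_mul,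
      integral_indicator_one measurableSet_Iic]
    · simp [Measure.real, hx]
    · exact ((integrable_const _).indicator measurableSet_Iic).const_mul _

theorem measurable_rowSign (d : ℕ) (t : ℝ) (z : ℕ → Bool) : Measurable (rowSign d t z) := by
  unfold rowSign
  exact Finset.measurable_fun_prod _ fun b _ =>
    (measurable_sign_decide (1 / (4 * t)) (z b)).comp (measurable_pi_apply b)

theorem rowSign_eq (d : ℕ) (t : ℝ) (z : ℕ → Bool) (r : ℕ → unitInterval) :
    rowSign d t z r = 1 ∨ rowSign d t z r = -1 := by
  unfold rowSign
  induction d with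
  | zero => simp
  | succ d ih =>
    rw [Finset.prod_range_succ]
    rcases ih with h | h <;> rw [h] <;>
      cases (decide ((r d : ℝ) ≤ 1 / (4 * t)) && z d) <;> simp [sign]

/-- By independence the expectation of the product factors: a marked place contributes `1 - 2/(4t)`,
an unmarked one contributes 1. -/
theorem integral_rowSign {d : ℕ} {t : ℝ} (ht : 1 ≤ t) (z : ℕ → Bool) :
    ∫ r, rowSign d t z r ∂rowLaw =
      (1 - 1 / (2 * t)) ^ ((Finset.range d).filter fun b => z b = true).card := by
  set f : ℕ → unitInterval → ℝ := fun b u => sign (decide ((u : ℝ) ≤ 1 / (4 * t)) && z b) with hf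
  have hm : ∀ b, Measurable (f b) := fun b => measurable_sign_decide _ _
  have hind : iIndepFun (fun (b : ℕ) (r : ℕ → unitInterval) => f b (r b)) rowLaw :=
    iIndepFun_infinitePi hm
  have hind' := hind.precomp (g := fun b : Fin d => (b : ℕ)) Fin.val_injective
  have h1 : ∀ r, rowSign d t z r = ∏ b : Fin d, f b (r b) := fun r =>
    Finset.prod_range fun b => f b (r b)
  simp_rw [h1]
  rw [hind'.integral_fun_prod_eq_prod_integral fun b =>
    (show Measurable fun r : ℕ → unitInterval => f b (r b) from
      (hm b).comp (measurable_pi_apply _)).aestronglyMeasurable]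
  have h2 : ∀ b : ℕ, ∫ r, f b (r b) ∂rowLaw = if z b then 1 - 1 / (2 * t) else 1 := by
    intro b
    have hmap : rowLaw.map (fun r => r b) = volume := Measure.infinitePi_map_eval _ b
    rw [← integral_map (φ := fun r : ℕ → unitInterval => r b) (f := f b)
      (measurable_pi_apply b).aemeasurable (hm b).aestronglyMeasurable, hmap,
      integral_sign_decide (by positivity) (by rw [div_le_one (by positivity)]; linarith)]
    congr 2
    field_simp
    norm_num
  simp_rw [h2]
  rw [← Finset.prod_range fun b => if z b then 1 - 1 / (2 * t) else 1, Finset.prod_ite]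
  simp

/-- The number of odd rows, as a function of the draws for a single matrix. -/
def oddRowsOf (k d : ℕ) (t : ℝ) (z : ℕ → Bool) (η : ℕ → ℕ → unitInterval) : ℝ :=
  ∑ a ∈ Finset.range k, (1 - rowSign d t z (η a)) / 2

/-- Currying the product measure twice exhibits the rows of a single matrix as independent copies of
`rowLaw`. -/
theorem map_coinLaw (s : ℕ) :
    coinLaw.map (fun ω a b => ω (s, a, b)) = Measure.infinitePi fun _ : ℕ => rowLaw := by
  have h1 : coinLaw.map (MeasurableEquiv.curry ℕ (ℕ × ℕ) unitInterval) =
      Measure.infinitePi fun _ : ℕ => Measure.infinitePi fun _ : ℕ × ℕ => volume :=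
    Measure.infinitePi_map_curry fun _ _ => volume
  have h2 : (Measure.infinitePi fun _ : ℕ × ℕ => (volume : Measure unitInterval)).map
      (MeasurableEquiv.curry ℕ ℕ unitInterval) = Measure.infinitePi fun _ : ℕ => rowLaw :=
    Measure.infinitePi_map_curry fun _ _ => volume
  have h3 := Measure.infinitePi_map_eval (fun _ : ℕ => Measure.infinitePi fun _ : ℕ × ℕ =>
    (volume : Measure unitInterval)) s
  have m1 : Measurable fun (x : ℕ → ℕ × ℕ → unitInterval) => x s := measurable_pi_apply s
  rw [← h2, ← h3, ← h1, Measure.map_map m1 (MeasurableEquiv.measurable _),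
    Measure.map_map (MeasurableEquiv.measurable _) (m1.comp (MeasurableEquiv.measurable _))]
  rfl

/-! ### Hoeffding tails for the number of odd rows -/

section Tails

variable (k : ℕ) {d : ℕ} {t g : ℝ} (z : ℕ → Bool)

/-- Hoeffding's lemma for a variable with values in `[0,1]`; the variance proxy is `((1 - 0)/2)^2`.
-/
theorem hasSubgaussianMGF_row (ht : 1 ≤ t) (a : ℕ) :
    HasSubgaussianMGF (fun η : ℕ → ℕ → unitInterval => (1 - rowSign d t z (η a)) / 2 -
      oddProb t ((Finset.range d).filter fun b => z b = true).card) (1 / 4)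
      (Measure.infinitePi fun _ : ℕ => rowLaw) := by
  have hm : Measurable fun r => (1 - rowSign d t z r) / 2 :=
    ((measurable_const.sub (measurable_rowSign d t z)).div_const 2)
  have hmap : (Measure.infinitePi fun _ : ℕ => rowLaw).map
      (fun η : ℕ → ℕ → unitInterval => η a) = rowLaw := Measure.infinitePi_map_eval _ a
  have key := hasSubgaussianMGF_of_mem_Icc (a := 0) (b := 1)
    (μ := Measure.infinitePi fun _ : ℕ => rowLaw)
    (X := fun η : ℕ → ℕ → unitInterval => (1 - rowSign d t z (η a)) / 2)
    (hm.comp (measurable_pi_apply a)).aemeasurable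
    (Filter.Eventually.of_forall fun η => by
      rcases rowSign_eq d t z (η a) with h | h <;> simp [h])
  have hint : ∫ η, (1 - rowSign d t z (η a)) / 2 ∂(Measure.infinitePi fun _ : ℕ => rowLaw) =
      oddProb t ((Finset.range d).filter fun b => z b = true).card := by
    rw [← integral_map (φ := fun η : ℕ → ℕ → unitInterval => η a)
      (f := fun r => (1 - rowSign d t z r) / 2)
      (measurable_pi_apply a).aemeasurable hm.aestronglyMeasurable, hmap, integral_div,
      integral_sub (integrable_const _), integral_rowSign ht, oddProb, Real.rpow_natCast]
    · simp
    · refine Integrable.of_mem_Icc (-1) 1 (measurable_rowSign d t z).aemeasurable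
        (Filter.Eventually.of_forall fun r => ?_)
      rcases rowSign_eq d t z r with h | h <;> simp [h]
  rw [hint] at key
  convert key using 1
  ext
  simp
  norm_num

theorem iIndepFun_row :
    iIndepFun (fun (a : ℕ) (η : ℕ → ℕ → unitInterval) => (1 - rowSign d t z (η a)) / 2 -
      oddProb t ((Finset.range d).filter fun b => z b = true).card)
      (Measure.infinitePi fun _ : ℕ => rowLaw) :=
  iIndepFun_infinitePi (X := fun _ r => (1 - rowSign d t z r) / 2 -
      oddProb t ((Finset.range d).filter fun b => z b = true).card) fun _ =>
    ((measurable_const.sub (measurable_rowSign d t z)).div_const 2).sub_const _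

theorem exp_hoeffding (g : ℝ) :
    Real.exp (-(k * g) ^ 2 / (2 * ((∑ _a ∈ Finset.range k, (1 / 4 : NNReal) : NNReal) : ℝ))) =
      Real.exp (-2 * g ^ 2 * k) := by
  congr 1
  rcases Nat.eq_zero_or_pos k with rfl | hk
  · simp
  · have : (k : ℝ) ≠ 0 := by positivity
    simp only [Finset.sum_const, Finset.card_range, nsmul_eq_mul, NNReal.coe_mul,
      NNReal.coe_natCast, NNReal.coe_div, NNReal.coe_one, NNReal.coe_ofNat]
    field_simp
    norm_num

theorem oddRowsOf_ge (ht : 1 ≤ t) (hg : 0 ≤ g) :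
    (Measure.infinitePi fun _ : ℕ => rowLaw).real {η | (oddProb t
      ((Finset.range d).filter fun b => z b = true).card + g) * k ≤ oddRowsOf k d t z η} ≤
      Real.exp (-2 * g ^ 2 * k) := by
  have := HasSubgaussianMGF.measure_sum_ge_le_of_iIndepFun (iIndepFun_row (d := d) (t := t) z)
    (s := Finset.range k) (fun a _ => hasSubgaussianMGF_row z ht a)
    (show 0 ≤ k * g by positivity)
  rw [exp_hoeffding] at this
  convert this using 3
  ext η
  rw [Finset.sum_sub_distrib, oddRowsOf]
  simp
  constructor <;> intro h <;> linarith

theorem oddRowsOf_le (ht : 1 ≤ t) (hg : 0 ≤ g) :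
    (Measure.infinitePi fun _ : ℕ => rowLaw).real {η | oddRowsOf k d t z η ≤ (oddProb t
      ((Finset.range d).filter fun b => z b = true).card - g) * k} ≤
      Real.exp (-2 * g ^ 2 * k) := by
  have := HasSubgaussianMGF.measure_sum_ge_le_of_iIndepFun
    ((iIndepFun_row (d := d) (t := t) z).comp (fun _ x => -x) fun _ => measurable_neg)
    (s := Finset.range k) (fun a _ => (hasSubgaussianMGF_row z ht a).neg)
    (show 0 ≤ k * g by positivity)
  rw [exp_hoeffding] at this
  convert this using 3
  ext η
  simp only [Function.comp]
  rw [Finset.sum_neg_distrib, Finset.sum_sub_distrib, oddRowsOf]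
  simp
  constructor <;> intro h <;> linarith

end Tails

/-! ### Transfer of the tails to the full source of randomness -/

section Coins

variable {n d : ℕ} (p : Fin n → Cube d) (i j : Fin n) (k s : ℕ) {t g : ℝ}

theorem card_filter_inputArray :
    ((Finset.range d).filter fun b => (inputArray p i b ^^ inputArray p j b) = true).card =
      hammingDist (p i) (p j) := by
  rw [hammingDist, Finset.card_filter, Finset.card_filter,
    Finset.sum_range fun b => if (inputArray p i b ^^ inputArray p j b) = true then 1 else 0]
  refine Finset.sum_congr rfl fun b _ => ?_
  simp [inputArray]

/-- The inequality holds for arbitrary `S`, so no tail event has to be shown measurable. -/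
theorem coinLaw_real_le (S : Set (ℕ → ℕ → unitInterval)) :
    coinLaw.real {ω | (fun a b => ω (s, a, b)) ∈ S} ≤
      (Measure.infinitePi fun _ : ℕ => rowLaw).real S := by
  refine ENNReal.toReal_mono (measure_ne_top _ _) ?_
  rw [← map_coinLaw s]
  have hm : Measurable fun (ω : Coins) (a b : ℕ) => ω (s, a, b) :=
    measurable_pi_lambda _ fun a => measurable_pi_lambda _ fun b => measurable_pi_apply _
  exact Measure.le_map_apply hm.aemeasurable S

theorem coinLaw_oddRows_ge (ht : 1 ≤ t) (hg : 0 ≤ g) :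
    coinLaw.real {ω | (oddProb t (hammingDist (p i) (p j)) + g) * k ≤
      oddRows k d s t (inputArray p i) (inputArray p j) ω} ≤ Real.exp (-2 * g ^ 2 * k) := by
  rw [← card_filter_inputArray]
  exact (coinLaw_real_le s _).trans (oddRowsOf_ge k _ ht hg)

theorem coinLaw_oddRows_le (ht : 1 ≤ t) (hg : 0 ≤ g) :
    coinLaw.real {ω | oddRows k d s t (inputArray p i) (inputArray p j) ω ≤
      (oddProb t (hammingDist (p i) (p j)) - g) * k} ≤ Real.exp (-2 * g ^ 2 * k) := by
  rw [← card_filter_inputArray]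
  exact (coinLaw_real_le s _).trans (oddRowsOf_le k _ ht hg)

end Coins

/-! ### Separation of the odd-row probabilities -/

section Gap

variable {t : ℝ}

/-- Bernoulli's inequality. It keeps the slope of `oddProb t` near `t` bounded below uniformly in
`t`. -/
theorem half_le_rpow_self (ht : 1 ≤ t) : 1 / 2 ≤ (1 - 1 / (2 * t)) ^ t := by
  have h1 : 1 / (2 * t) ≤ 1 := by rw [div_le_one (by linarith)]; linarith
  have := one_add_mul_self_le_rpow_one_add (s := -(1 / (2 * t))) (by linarith) ht
  have h2 : t * -(1 / (2 * t)) = -(1 / 2) := by field_simp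
  rw [h2] at this
  rw [sub_eq_add_neg]
  linarith

theorem base_pos (ht : 1 ≤ t) : 0 < 1 - 1 / (2 * t) := by
  have h1 : 1 / (2 * t) < 1 := by rw [div_lt_one (by linarith)]; linarith
  linarith

/-- The base is at most `exp(-1/(2t))`, so raising the exponent from `x` to `y` multiplies the power
by at most `exp(-v) ≤ 1/(1+v)`. -/
theorem rpow_sub_rpow_ge (ht : 1 ≤ t) {x y v : ℝ} (hv : 0 ≤ v) (hxy : v ≤ (y - x) / (2 * t)) :
    (1 - 1 / (2 * t)) ^ x * (v / (1 + v)) ≤ (1 - 1 / (2 * t)) ^ x - (1 - 1 / (2 * t)) ^ y := by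
  set b := 1 - 1 / (2 * t) with hb
  have hb0 : 0 < b := base_pos ht
  have hyx : 0 ≤ y - x := by
    by_contra! h
    have := div_neg_of_neg_of_pos h (show 0 < 2 * t by linarith)
    linarith
  have h1 : b ≤ Real.exp (-(1 / (2 * t))) := by
    have := Real.add_one_le_exp (-(1 / (2 * t)))
    linarith
  have h2 : b ^ (y - x) ≤ Real.exp (-v) := by
    calc b ^ (y - x) ≤ Real.exp (-(1 / (2 * t))) ^ (y - x) :=
          Real.rpow_le_rpow hb0.le h1 hyx
      _ = Real.exp (-((y - x) / (2 * t))) := by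
          rw [← Real.exp_mul]; congr 1; ring
      _ ≤ Real.exp (-v) := Real.exp_le_exp.2 (by linarith)
  have h3 : Real.exp (-v) ≤ 1 / (1 + v) := by
    rw [Real.exp_neg, ← one_div]
    exact one_div_le_one_div_of_le (by linarith) (by linarith [Real.add_one_le_exp v])
  have h4 : b ^ y = b ^ x * b ^ (y - x) := by
    rw [← Real.rpow_add hb0]; congr 1; ring
  have h5 : v / (1 + v) = 1 - 1 / (1 + v) := by
    field_simp
    ring
  rw [h4, h5]
  have := Real.rpow_pos_of_pos hb0 x
  nlinarith

theorem div_one_add_mono {x y : ℝ} (hx : 0 ≤ x) (hxy : x ≤ y) : x / (1 + x) ≤ y / (1 + y) := by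
  rw [div_le_div_iff₀ (by linarith) (by linarith)]
  nlinarith

theorem one_add_mul_le_pow' {δ : ℝ} (hδ : 0 ≤ δ) (m : ℕ) : 1 + m * δ ≤ (1 + δ) ^ m :=
  one_add_mul_le_pow (by linarith) m

/-- The margin by which a test is right if the distance is `m` threshold steps away. -/
def margin (δ : ℝ) (m : ℕ) : ℝ := m * δ / (1 + m * δ) / 32

theorem margin_nonneg {δ : ℝ} (hδ : 0 ≤ δ) (m : ℕ) : 0 ≤ margin δ m := by
  unfold margin; positivity

/-- The gap of the probabilities is at least `y/(1+y)/12`. The summand `δ/30` of the cutoff supplies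
one further step, hence `m + 1`, and gives a positive margin even for `m = 0`. -/
theorem oddProb_add_margin_le {δ h : ℝ} (ht : 1 ≤ t) (h0 : 0 < δ) (m : ℕ)
    (hh : (1 + δ) ^ m * h ≤ t) (hh0 : 0 ≤ h) :
    oddProb t h + margin δ (m + 1) ≤ oddProb t t + δ / 30 := by
  set y := m * δ with hy
  have hy0 : 0 ≤ y := by positivity
  have hp : 1 + y ≤ (1 + δ) ^ m := one_add_mul_le_pow' h0.le m
  have hth : h ≤ t / (1 + y) := by
    rw [le_div_iff₀ (by linarith)]
    nlinarith
  have hht : h ≤ t := hth.trans (div_le_self (by linarith) (by linarith))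
  set v := y / (1 + y) / 2 with hv
  have hf1 : y / (1 + y) ≤ 1 := by rw [div_le_one (by linarith)]; linarith
  have hf0 : 0 ≤ y / (1 + y) := by positivity
  have hvle : v ≤ (t - h) / (2 * t) := by
    have : t - t / (1 + y) = t * (y / (1 + y)) := by field_simp; ring
    rw [le_div_iff₀ (by linarith), hv]
    nlinarith
  have h1 := rpow_sub_rpow_ge ht (by positivity) hvle
  have hb := half_le_rpow_self ht
  have hbh : (1 - 1 / (2 * t)) ^ t ≤ (1 - 1 / (2 * t)) ^ h := by
    have hq : 0 ≤ 1 / (2 * t) := by positivity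
    exact Real.rpow_le_rpow_of_exponent_ge (base_pos ht) (by linarith) hht
  have h2 : y / (1 + y) / 3 ≤ v / (1 + v) := by
    rw [le_div_iff₀ (by positivity), hv]
    nlinarith
  have h3 : 1 / 2 * (y / (1 + y) / 3) ≤ (1 - 1 / (2 * t)) ^ h * (v / (1 + v)) :=
    mul_le_mul (hb.trans hbh) h2 (by positivity) (by linarith)
  have h4 : margin δ (m + 1) ≤ (y / (1 + y) + δ) / 32 := by
    unfold margin
    gcongr
    rw [div_add' _ _ _ (by positivity), div_le_div_iff₀ (by positivity) (by positivity)]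
    push_cast
    nlinarith [mul_nonneg hy0 h0.le, mul_nonneg hy0 hy0, mul_nonneg (mul_nonneg hy0 h0.le) h0.le,
      mul_nonneg (mul_nonneg hy0 h0.le) hy0, mul_nonneg h0.le h0.le]
  unfold oddProb
  linarith

/-- Here `δ/30` works against the test: the gap is at least `y/(1+y)/8`, and for `m ≥ 1` this pays
for both `δ/30` and the margin. -/
theorem oddProb_le_sub_margin {δ h : ℝ} (ht : 1 ≤ t) (h0 : 0 < δ) (h1 : δ < 1 / 10) {m : ℕ}
    (hm : 1 ≤ m) (hh : (1 + δ) ^ m * t ≤ h) :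
    oddProb t t + δ / 30 ≤ oddProb t h - margin δ m := by
  set y := m * δ with hy
  have hm' : (1 : ℝ) ≤ m := by exact_mod_cast hm
  have hyδ : δ ≤ y := by nlinarith
  have hp : 1 + y ≤ (1 + δ) ^ m := one_add_mul_le_pow' h0.le m
  have hvle : y / 2 ≤ (h - t) / (2 * t) := by
    rw [le_div_iff₀ (by linarith)]
    nlinarith
  have e1 := rpow_sub_rpow_ge ht (by linarith) hvle
  have hb := half_le_rpow_self ht
  have e2 : y / (1 + y) / 2 ≤ y / 2 / (1 + y / 2) := by
    rw [div_div, div_div, div_le_div_iff₀ (by nlinarith) (by nlinarith)]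
    nlinarith
  have e3 : 1 / 2 * (y / (1 + y) / 2) ≤ (1 - 1 / (2 * t)) ^ t * (y / 2 / (1 + y / 2)) :=
    mul_le_mul hb e2 (by positivity) (by linarith)
  have e4 : δ / (1 + δ) ≤ y / (1 + y) := div_one_add_mono h0.le hyδ
  have e5 : δ ≤ 11 / 10 * (δ / (1 + δ)) := by
    rw [mul_div_assoc', le_div_iff₀ (by linarith)]
    nlinarith
  unfold oddProb margin
  linarith

end Gap

/-! ### Summing the error probabilities -/

/-- The subtracted power makes the induction close, as `x ≤ 1/2` gives `x^m ≤ 2 x^m - 2 x^(m+1)`.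
For `N ≤ c` truncated subtraction makes the bound 0. -/
theorem sum_pow_sub_le {x : ℝ} (hx : 0 ≤ x) (hx' : x ≤ 1 / 2) (c N : ℕ) :
    ∑ s ∈ Finset.range N, (if c ≤ s then x ^ (s - c) else 0) ≤ 2 - 2 * x ^ (N - c) := by
  induction N with
  | zero => simp
  | succ N ih =>
    rw [Finset.sum_range_succ]
    split_ifs with h
    · rw [show N + 1 - c = N - c + 1 by omega, pow_succ]
      have := pow_nonneg hx (N - c)
      nlinarith
    · rw [show N - c = 0 by omega] at ih
      rw [show N + 1 - c = 0 by omega]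
      linarith

theorem sum_pow_sub_le' {x : ℝ} (hx : 0 ≤ x) (hx' : x ≤ 1 / 2) (c N : ℕ) :
    ∑ s ∈ Finset.range N, (if s < c then x ^ (c - s) else 0) ≤ 2 * x ^ (c - N) := by
  induction N with
  | zero => simpa using pow_nonneg hx c
  | succ N ih =>
    rw [Finset.sum_range_succ]
    split_ifs with h
    · rw [show c - N = c - (N + 1) + 1 by omega, pow_succ] at ih ⊢
      have := pow_nonneg hx (c - (N + 1))
      nlinarith
    · rw [show c - N = 0 by omega] at ih
      rw [show c - (N + 1) = 0 by omega]
      linarith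

theorem sum_pow_dist_le {x : ℝ} (hx : 0 ≤ x) (hx' : x ≤ 1 / 2) (c N : ℕ) :
    ∑ s ∈ Finset.range N, x ^ ((s - c) + (c - s)) ≤ 4 := by
  have h1 := sum_pow_sub_le hx hx' c N
  have h2 := sum_pow_sub_le' hx hx' c N
  have h3 := pow_nonneg hx (N - c)
  have h4 : x ^ (c - N) ≤ 1 := pow_le_one₀ hx (by linarith)
  have : ∑ s ∈ Finset.range N, x ^ ((s - c) + (c - s)) =
      ∑ s ∈ Finset.range N, (if c ≤ s then x ^ (s - c) else 0) +
      ∑ s ∈ Finset.range N, (if s < c then x ^ (c - s) else 0) := by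
    rw [← Finset.sum_add_distrib]
    refine Finset.sum_congr rfl fun s _ => ?_
    by_cases h : c ≤ s
    · rw [if_pos h, if_neg (by omega), show c - s = 0 by omega]; simp
    · rw [if_neg h, if_pos (by omega), show s - c = 0 by omega]; simp
  linarith

/-- The margin is `δ y / 32` with `y = m/(1+mδ)`, so the exponent is at least `4 a y^2 ≥ 2 a y`. The
number `y` is at least `m/2` while `mδ ≤ 1`, and at least `1/(2δ)` afterwards. -/
theorem exp_margin_le {δ a : ℝ} {k m : ℕ} (h0 : 0 < δ) (h1 : δ < 1 / 10) (ha : 0 ≤ a)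
    (hk : 2048 * a / δ ^ 2 ≤ k) (hm : 1 ≤ m) :
    Real.exp (-2 * margin δ m ^ 2 * k) ≤ Real.exp (-(a * m)) + Real.exp (-(a / δ)) := by
  have hm' : (1 : ℝ) ≤ m := by exact_mod_cast hm
  set y : ℝ := m / (1 + m * δ) with hy
  have hden : 0 < 1 + m * δ := by positivity
  have hmar : margin δ m = δ * y / 32 := by rw [margin, hy]; ring
  have hy1 : 1 / 2 ≤ y := by
    rw [hy, le_div_iff₀ hden]; nlinarith
  have h2 : 4 * a * y ^ 2 ≤ 2 * margin δ m ^ 2 * k := by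
    rw [div_le_iff₀ (by positivity)] at hk
    rw [hmar]
    have : 0 ≤ y ^ 2 := by positivity
    nlinarith
  have h3 : 2 * (a * y) ≤ 4 * a * y ^ 2 := by nlinarith [mul_nonneg ha (show 0 ≤ y by linarith)]
  rcases le_total (m * δ) 1 with h | h
  · have : m / 2 ≤ y := by
      rw [hy, div_le_div_iff₀ (by norm_num) hden]; nlinarith
    have h4 : Real.exp (-2 * margin δ m ^ 2 * k) ≤ Real.exp (-(a * m)) :=
      Real.exp_le_exp.2 (by nlinarith)
    linarith [Real.exp_pos (-(a / δ))]
  · have : 1 / δ / 2 ≤ y := by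
      rw [hy, div_div, div_le_div_iff₀ (by positivity) hden]; nlinarith
    have h4 : Real.exp (-2 * margin δ m ^ 2 * k) ≤ Real.exp (-(a / δ)) := by
      refine Real.exp_le_exp.2 ?_
      have : a / δ = 2 * (a * (1 / δ / 2)) := by ring
      nlinarith [mul_le_mul_of_nonneg_left ‹1 / δ / 2 ≤ y› ha]
    linarith [Real.exp_pos (-(a * m))]

/-! ### The probability of success -/

/-- The test of the points `i`, `j` at the threshold number `s` gives a wrong answer although
their distance is not close to the threshold. -/
def badEvent {n d : ℕ} (p : Fin n → Cube d) (k : ℕ) (δ : ℝ) (i j : Fin n) (s : ℕ) : Set Coins :=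
  {ω | ¬ (((hammingDist (p i) (p j) : ℝ) ≤ (1 + δ) ^ s →
      oddRows k d s ((1 + δ) ^ s) (inputArray p i) (inputArray p j) ω ≤
        (oddProb ((1 + δ) ^ s) ((1 + δ) ^ s) + δ / 30) * k) ∧
    ((1 + δ) ^ (s + 1) ≤ (hammingDist (p i) (p j) : ℝ) →
      (oddProb ((1 + δ) ^ s) ((1 + δ) ^ s) + δ / 30) * k <
        oddRows k d s ((1 + δ) ^ s) (inputArray p i) (inputArray p j) ω))}

/-- Here `c` is the first threshold number that reaches the distance, and the truncated differences
add up to `|s - c|`. The error decays geometrically in `|s - c|` down to a floor `exp(-a/δ)`. -/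
theorem exists_badEvent_le {n d : ℕ} (p : Fin n → Cube d) {k : ℕ} {δ a : ℝ} (h0 : 0 < δ)
    (h1 : δ < 1 / 10) (ha : 0 ≤ a) (hk : 2048 * a / δ ^ 2 ≤ k) (i j : Fin n) :
    ∃ c : ℕ, ∀ s, coinLaw.real (badEvent p k δ i j s) ≤
      Real.exp (-(a / 3)) * Real.exp (-(a / 3)) ^ ((s - c) + (c - s)) + Real.exp (-(a / δ)) := by
  classical
  set h : ℝ := ((hammingDist (p i) (p j) : ℕ) : ℝ) with hh
  have hh0 : 0 ≤ h := by positivity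
  have hδ1 : 1 < 1 + δ := by linarith
  have hex : ∃ c : ℕ, h ≤ (1 + δ) ^ c := (pow_unbounded_of_one_lt h hδ1).imp fun _ => le_of_lt
  refine ⟨Nat.find hex, fun s => ?_⟩
  set c := Nat.find hex with hc
  have hcs : h ≤ (1 + δ) ^ c := Nat.find_spec hex
  have hcm : ∀ r < c, (1 + δ) ^ r < h := fun r hr => not_le.1 (Nat.find_min hex hr)
  have ht : 1 ≤ (1 + δ) ^ s := one_le_pow₀ hδ1.le
  -- The factor 3 is forced by `c - s = 2`, where only `m = 1` step is available.
  have hfin : ∀ m : ℕ, 1 ≤ m → (s - c) + (c - s) + 1 ≤ 3 * m →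
      Real.exp (-2 * margin δ m ^ 2 * k) ≤
      Real.exp (-(a / 3)) * Real.exp (-(a / 3)) ^ ((s - c) + (c - s)) + Real.exp (-(a / δ)) := by
    intro m hm hm3
    refine (exp_margin_le h0 h1 ha hk hm).trans (add_le_add_left ?_ _)
    rw [← pow_succ', ← Real.exp_nat_mul]
    refine Real.exp_le_exp.2 ?_
    have : (((s - c) + (c - s) + 1 : ℕ) : ℝ) ≤ 3 * m := by exact_mod_cast hm3
    nlinarith
  by_cases hA : h ≤ (1 + δ) ^ s
  · have hcs' : c ≤ s := Nat.find_min' hex hA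
    have hB : ¬ (1 + δ) ^ (s + 1) ≤ h := by
      rw [not_le, pow_succ]; nlinarith
    have hgap := oddProb_add_margin_le (h := h) ht h0 (s - c) (by
      calc (1 + δ) ^ (s - c) * h ≤ (1 + δ) ^ (s - c) * (1 + δ) ^ c := by gcongr
        _ = (1 + δ) ^ s := by rw [← pow_add]; congr 1; omega) hh0
    refine le_trans (measureReal_mono ?_) ((coinLaw_oddRows_ge p i j k s ht
      (margin_nonneg h0.le (s - c + 1))).trans (hfin _ (by omega) (by omega)))
    intro ω hω
    simp only [badEvent, Set.mem_ofPred_eq, ← hh, hA, hB, true_imp_iff, false_imp_iff, and_true,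
      not_le] at hω ⊢
    exact (mul_le_mul_of_nonneg_right hgap (Nat.cast_nonneg k)).trans hω.le
  · by_cases hB : (1 + δ) ^ (s + 1) ≤ h
    · have hsc : s < c := by
        by_contra! hcs'
        exact hA (hcs.trans (pow_le_pow_right₀ hδ1.le hcs'))
      have hM : (1 + δ) ^ (max 1 (c - 1 - s)) * (1 + δ) ^ s ≤ h := by
        rw [← pow_add]
        rcases le_or_gt (c - 1 - s) 1 with hle | hlt
        · rw [max_eq_left hle, add_comm 1 s]; exact hB
        · rw [max_eq_right hlt.le]; exact (hcm _ (by omega)).le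
      have hgap := oddProb_le_sub_margin ht h0 h1 (le_max_left _ _) hM
      refine le_trans (measureReal_mono ?_) ((coinLaw_oddRows_le p i j k s ht
        (margin_nonneg h0.le (max 1 (c - 1 - s)))).trans (hfin _ (by omega) (by omega)))
      intro ω hω
      simp only [badEvent, Set.mem_ofPred_eq, ← hh, hA, hB, true_imp_iff, false_imp_iff, true_and,
        not_lt] at hω ⊢
      exact hω.trans (mul_le_mul_of_nonneg_right hgap (Nat.cast_nonneg k))
    · have : badEvent p k δ i j s = ∅ := by
        ext ω
        simp only [badEvent, Set.mem_ofPred_eq, ← hh, hA, hB, false_imp_iff, and_true,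
          not_true_eq_false, Set.mem_empty_iff_false]
      rw [this, measureReal_empty]
      positivity

theorem union_badEvent_le {n d : ℕ} (p : Fin n → Cube d) {k : ℕ} {δ a : ℝ} (h0 : 0 < δ)
    (h1 : δ < 1 / 10) (ha : 0 ≤ a) (hk : 2048 * a / δ ^ 2 ≤ k) (ha' : Real.exp (-(a / 3)) ≤ 1 / 2)
    (L : ℕ) :
    coinLaw.real (⋃ i, ⋃ j, ⋃ s ∈ Finset.range (L + 1), badEvent p k δ i j s) ≤
      n ^ 2 * (4 * Real.exp (-(a / 3)) + (L + 1) * Real.exp (-(a / δ))) := by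
  have hpair : ∀ i j, coinLaw.real (⋃ s ∈ Finset.range (L + 1), badEvent p k δ i j s) ≤
      4 * Real.exp (-(a / 3)) + (L + 1) * Real.exp (-(a / δ)) := by
    intro i j
    obtain ⟨c, hc⟩ := exists_badEvent_le p h0 h1 ha hk i j
    refine (measureReal_biUnion_finset_le _ _).trans ((Finset.sum_le_sum fun s _ => hc s).trans ?_)
    rw [Finset.sum_add_distrib, ← Finset.mul_sum]
    have := sum_pow_dist_le (Real.exp_pos (-(a / 3))).le ha' c (L + 1)
    simp only [Finset.sum_const, Finset.card_range, nsmul_eq_mul]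
    push_cast
    nlinarith [Real.exp_pos (-(a / 3))]
  calc _ ≤ ∑ i : Fin n, ∑ j : Fin n, (4 * Real.exp (-(a / 3)) + (L + 1) * Real.exp (-(a / δ))) :=
        (measureReal_iUnion_fintype_le _).trans (Finset.sum_le_sum fun i _ =>
          (measureReal_iUnion_fintype_le _).trans (Finset.sum_le_sum fun j _ => hpair i j))
    _ = _ := by simp; ring

/-- The failure probability is at most `n ^ (-α)`. -/
theorem failure_bound {n β L d : ℕ} {α κ δ : ℝ} (hα : 1 ≤ α) (hn : 2 ≤ n) (h0 : 0 < δ)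
    (h1 : δ < 1 / 10) (hκ : 5 + β + α ≤ κ) (hd0 : 1 ≤ d) (hd : d ≤ 2 ^ n ^ β)
    (hL : (L : ℝ) ≤ Real.log d / Real.log (1 + δ) + 1) :
    n ^ 2 * (4 * Real.exp (-(3 * κ * Real.log n / 3)) +
      (L + 1) * Real.exp (-(3 * κ * Real.log n / δ))) ≤ 1 / (n : ℝ) ^ α := by
  have hn' : (2 : ℝ) ≤ n := by exact_mod_cast hn
  have hn0 : (0 : ℝ) < n := by linarith
  have hβ : (0 : ℝ) ≤ β := by positivity
  have hlog2 := Real.log_two_gt_d9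
  have hlog2' := Real.log_two_lt_d9
  have hlogn : Real.log 2 ≤ Real.log n := Real.log_le_log (by norm_num) hn'
  have hnβ : (1 : ℝ) ≤ (n : ℝ) ^ β := one_le_pow₀ (by linarith)
  have hpow : ∀ x : ℝ, Real.exp (-(x * Real.log n)) = (n : ℝ) ^ (-x) := by
    intro x
    rw [Real.rpow_def_of_pos hn0]; congr 1; ring
  have hlogd : Real.log d ≤ n ^ β * Real.log 2 := by
    have hd1 : (d : ℝ) ≤ 2 ^ n ^ β := by exact_mod_cast hd
    have := Real.log_le_log (by exact_mod_cast hd0) hd1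
    rw [Real.log_pow] at this
    exact_mod_cast this
  have hlogd0 : 0 ≤ Real.log d := Real.log_natCast_nonneg d
  have hlogδ : δ * (10 / 11) ≤ Real.log (1 + δ) := by
    have := Real.one_sub_inv_le_log_of_pos (show 0 < 1 + δ by linarith)
    refine le_trans ?_ this
    rw [show 1 - (1 + δ)⁻¹ = δ / (1 + δ) by field_simp; ring, le_div_iff₀ (by linarith)]
    nlinarith
  -- Since `log 2 * 11/10 < 4/5`, a fifth of the right side is left; it is at least 2 because `1/δ ≥
  -- 10`, and it covers the rounding and the extra threshold.
  have hL1 : (L : ℝ) + 1 ≤ n ^ β * (1 / δ) := by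
    have e1 : Real.log d / Real.log (1 + δ) ≤ n ^ β * Real.log 2 / (δ * (10 / 11)) :=
      div_le_div₀ (by positivity) hlogd (by positivity) hlogδ
    have e2 : n ^ β * Real.log 2 / (δ * (10 / 11)) ≤ 4 / 5 * (n ^ β * (1 / δ)) := by
      rw [show n ^ β * Real.log 2 / (δ * (10 / 11)) =
        (Real.log 2 * (11 / 10)) * (n ^ β * (1 / δ)) by field_simp]
      gcongr
      linarith
    have e3 : 10 ≤ 1 / δ := by rw [le_div_iff₀ h0]; linarith
    have e4 : 10 ≤ n ^ β * (1 / δ) := by nlinarith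
    linarith
  have hκlog : 1 ≤ 3 * κ * Real.log n := by nlinarith
  have hexp : (L + 1) * Real.exp (-(3 * κ * Real.log n / δ)) ≤
      n ^ β * (3 * Real.exp (-(κ * Real.log n))) := by
    -- The unbounded factor `1/δ` is absorbed by the exponential, at the price of 1 in the
    -- coefficient of `1/δ` in the exponent.
    have e1 : 1 / δ ≤ Real.exp (1 / δ) := by linarith [Real.add_one_le_exp (1 / δ)]
    have e2 : (1 / δ) * Real.exp (-(3 * κ * Real.log n / δ)) ≤
        3 * Real.exp (-(κ * Real.log n)) := by
      calc (1 / δ) * Real.exp (-(3 * κ * Real.log n / δ))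
          ≤ Real.exp (1 / δ) * Real.exp (-(3 * κ * Real.log n / δ)) := by gcongr
        _ = Real.exp (-((3 * κ * Real.log n - 1) * (1 / δ))) := by
            rw [← Real.exp_add]; congr 1; ring
        _ ≤ Real.exp (1 + -(κ * Real.log n)) := by
            refine Real.exp_le_exp.2 ?_
            have e3 : 1 ≤ 1 / δ := by rw [le_div_iff₀ h0]; linarith
            nlinarith
        _ = Real.exp 1 * Real.exp (-(κ * Real.log n)) := Real.exp_add _ _
        _ ≤ 3 * Real.exp (-(κ * Real.log n)) := by
            gcongr
            linarith [Real.exp_one_lt_d9]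
    calc (L + 1) * Real.exp (-(3 * κ * Real.log n / δ))
        ≤ (n ^ β * (1 / δ)) * Real.exp (-(3 * κ * Real.log n / δ)) := by gcongr
      _ = n ^ β * ((1 / δ) * Real.exp (-(3 * κ * Real.log n / δ))) := by ring
      _ ≤ _ := by gcongr
  have hE : Real.exp (-(κ * Real.log n)) ≤ (n : ℝ) ^ (-(5 + β + α)) := by
    rw [hpow]
    exact Real.rpow_le_rpow_of_exponent_le (by linarith) (by linarith)
  rw [show 3 * κ * Real.log n / 3 = κ * Real.log n by ring]
  calc (n : ℝ) ^ 2 * (4 * Real.exp (-(κ * Real.log n)) +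
      (L + 1) * Real.exp (-(3 * κ * Real.log n / δ)))
      ≤ n ^ 2 * (4 * (n ^ β * Real.exp (-(κ * Real.log n))) +
        n ^ β * (3 * Real.exp (-(κ * Real.log n)))) := by
        gcongr
        exact le_mul_of_one_le_left (Real.exp_pos _).le hnβ
    _ = 7 * (n ^ 2 * n ^ β * Real.exp (-(κ * Real.log n))) := by ring
    -- The constant `7 = 4 + 3` is below `2^3 ≤ n^3`; thus the 5 in the exponent is `3 + 2`.
    _ ≤ n ^ 3 * (n ^ 2 * n ^ β * (n : ℝ) ^ (-(5 + β + α))) := by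
        have : (2 : ℝ) ^ 3 ≤ n ^ 3 := by gcongr
        gcongr
        linarith
    _ = 1 / (n : ℝ) ^ α := by
        rw [one_div, ← Real.rpow_neg hn0.le, show -(5 + β + α) = -((5 + β : ℕ) : ℝ) + -α by
          push_cast; ring, Real.rpow_add hn0, Real.rpow_neg hn0.le, Real.rpow_natCast, pow_add]
        field_simp

theorem succeeds_prob_ge {K n d ℓ β : ℕ} {α ε : ℝ} {p : Fin n → Cube d} (hα : 1 ≤ α)
    (hK : 6144 * (5 + β + α) ≤ K) (hp : Function.Injective p) (hℓ : 1 ≤ ℓ) (hℓn : ℓ < n)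
    (h0 : 0 < ε) (h1 : ε < 1 / 2) (hd : d ≤ 2 ^ n ^ β) :
    1 - 1 / (n : ℝ) ^ α ≤ coinLaw.real {ω | Succeeds ℓ p (2 + ε) (run K ℓ p (ε / 5) ω).val} := by
  set δ := ε / 5 with hδ
  have hδ0 : 0 < δ := by positivity
  have hδ1 : δ < 1 / 10 := by linarith
  have hn : 2 ≤ n := by omega
  have hn' : (2 : ℝ) ≤ n := by exact_mod_cast hn
  have hd0 : 1 ≤ d := by
    rcases Nat.eq_zero_or_pos d with rfl | h
    · have := @hp ⟨0, by omega⟩ ⟨1, by omega⟩ (Subsingleton.elim _ _)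
      simp at this
    · exact h
  set k := (sketchLength K n δ).val with hk
  set L := (lastThreshold d δ).val with hL
  -- The rate is `a = 3 κ log n`: 6144 is `3 * 2048`, with 2048 from `exp_margin_le` and 3 from the
  -- loss in `exists_badEvent_le`.
  set κ : ℝ := K / 6144 with hκ
  have hβ : (0 : ℝ) ≤ β := by positivity
  have hκ' : 5 + β + α ≤ κ := by rw [hκ, le_div_iff₀ (by norm_num)]; linarith
  have hlog2 := Real.log_two_gt_d9
  have hlogn : Real.log 2 ≤ Real.log n := Real.log_le_log (by norm_num) hn'
  have hlogδ : 0 < Real.log (1 + δ) := Real.log_pos (by linarith)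
  have hk' : 2048 * (3 * κ * Real.log n) / δ ^ 2 ≤ k := by
    have : K * Real.log n / (δ * δ) ≤ k := Nat.le_ceil _
    refine le_trans (le_of_eq ?_) this
    rw [hκ]; ring
  have hLle : (L : ℝ) ≤ Real.log d / Real.log (1 + δ) + 1 :=
    (Nat.ceil_lt_add_one (div_nonneg (Real.log_natCast_nonneg d) hlogδ.le)).le
  have hdL : (d : ℝ) ≤ (1 + δ) ^ L := by
    have h2 : Real.log d / Real.log (1 + δ) ≤ L := Nat.le_ceil _
    rw [div_le_iff₀ hlogδ, ← Real.log_pow] at h2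
    exact (Real.log_le_log_iff (by exact_mod_cast hd0) (by positivity)).1 h2
  have hhalf : Real.exp (-(3 * κ * Real.log n / 3)) ≤ 1 / 2 := by
    rw [show (1 / 2 : ℝ) = Real.exp (-Real.log 2) by
      rw [Real.exp_neg, Real.exp_log (by norm_num)]; norm_num]
    refine Real.exp_le_exp.2 ?_
    nlinarith
  have hbad := (union_badEvent_le p hδ0 hδ1 (by positivity) hk' hhalf L).trans
    (failure_bound hα hn hδ0 hδ1 hκ' hd0 hd hLle)
  set B := ⋃ i, ⋃ j, ⋃ s ∈ Finset.range (L + 1), badEvent p k δ i j s with hB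
  set S := {ω | Succeeds ℓ p (2 + ε) (run K ℓ p δ ω).val} with hS
  -- Covering the whole space and using subadditivity avoids complements, so measurability of the
  -- success event is not needed.
  have hcov : (Set.univ : Set Coins) ⊆ S ∪ B := by
    intro ω _
    by_contra hω
    rw [Set.mem_union, not_or] at hω
    have hgood : ∀ i j, ∀ s ≤ L, ω ∉ badEvent p k δ i j s := by
      intro i j s hs hmem
      refine hω.2 ?_
      simp only [hB, Set.mem_iUnion, Finset.mem_range]
      exact ⟨i, j, s, by omega, hmem⟩
    simp only [badEvent, Set.mem_ofPred_eq, not_not] at hgood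
    refine hω.1 (succeeds_of_tests hp hℓ hℓn hδ0.le ?_ hk.symm hL.symm hdL
      (fun i j _ s hs => (hgood i j s hs).1) (fun i j _ s hs => (hgood i j s hs).2))
    rw [hδ]; nlinarith
  have h2 : coinLaw.real (Set.univ : Set Coins) ≤ coinLaw.real S + coinLaw.real B :=
    (measureReal_mono hcov).trans (measureReal_union_le _ _)
  rw [probReal_univ] at h2
  linarith

end HammingCluster
end

theorem mainTheorem7 (α : ℝ) (hα : 1 ≤ α) (β : ℕ) :
    ∃ K₀ : ℕ, ∀ K : ℕ, K₀ ≤ K → ∃ C : ℝ,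
      ∀ (n d ℓ : ℕ) (p : Fin n → HammingCluster.Cube d) (ε : ℝ),
        Function.Injective p → 1 ≤ ℓ → ℓ < n → 0 < ε → ε < 1 / 2 →
        (2 ≤ d → ∀ ω : HammingCluster.Coins,
          ((HammingCluster.run K ℓ p (ε / 5) ω).cost : ℝ) ≤
            C * (n * Real.log n *
              (d * Real.logb (1 + ε / 5) d + ℓ * Real.log (Real.logb (1 + ε / 5) d)) /
                ε ^ 2)) ∧
        (d ≤ 2 ^ n ^ β →
          1 - 1 / (n : ℝ) ^ α ≤
            HammingCluster.coinLaw.real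
              {ω | HammingCluster.Succeeds ℓ p (2 + ε)
                (HammingCluster.run K ℓ p (ε / 5) ω).val}) := by
  refine ⟨⌈6144 * (5 + β + α)⌉₊, fun K hK => ⟨140 * (25 * K + 2), ?_⟩⟩
  intro n d ℓ p ε hp hℓ hℓn h0 h1
  exact ⟨fun hd ω => HammingCluster.run_cost_le K p hℓ (by omega) h0 h1 hd ω,
    HammingCluster.succeeds_prob_ge hα (Nat.ceil_le.1 hK) hp hℓ hℓn h0 h1⟩
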